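/- For real parameters $a=(a_1,\dots,a_p)$, $b=(b_1,\dots,b_q)$ let $${}_pF_{q}(a;b;x)=\sum_{n\ge 0}\frac{(a_1)_n\cdots(a_p)_n}{(b_1)_n\cdots(b_q)_n\,n!}\,x^n .$$ Let $0\le p\le q+1$, let $a_i>0$ and $b_j>0$, put $B=(1,b_1,\dots,b_q)$ and $r=q+1-p$, and suppose that, with $e_k$ the elementary symmetric polynomials, $$\frac{e_{q+1}(B)}{e_{p}(a)}\le\frac{e_{q}(B)}{e_{p-1}(a)}\le\dots\le\frac{e_{r+1}(B)}{e_1(a)}\le e_r(B)$$ (no condition if $p=0$). Put $$g(\nu,x)=\frac1{\Gamma(\nu)}\,{}_pF_{q+1}(a;\nu,b;x)=\sum_{n\ge0}\frac{(a_1)_n\cdots(a_p)_n}{(b_1)_n\cdots(b_q)_n\,n!}\,\frac{x^n}{\Gamma(\nu+n)},$$ where $1/\Gamma=0$ at $0,-1,-2,\dots$; the last series converges for all real $\nu,x$, is continuous in $\nu$, and defines $g$ at $\nu=0,-1,-2,\dots$. Then: 1. For each fixed $x\ge0$ the function $\nu\mapsto g(\nu,x)$ is strictly discrete Wright log-concave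 on $(0,\infty)$: it is positive and continuous, and $g(\nu+h,x)g(\nu+s,x)>g(\nu,x)g(\nu+h+s,x)$ for all $\nu>0$, $s>0$ and integers $h\ge1$. Now let $\mu\ge-1$, $\beta>0$, $\mu+\beta\ge0$ and $$\lambda_{\beta,\mu}(x)=g(\mu+1,x)g(\mu+\beta,x)-g(\mu,x)g(\mu+\beta+1,x).$$ Call $(\mu,\beta,a,b)$ exceptional if $\mu=-1$, $\beta=1$ and $(a_1,\dots,a_p)$ is a permutation of $(1,b_1,\dots,b_q)$. 2. $\lambda_{\beta,\mu}(x)=\sum_{m\ge0}\lambda_m x^m$ for all real $x$, with all $\lambda_m\ge0$. Moreover $\lambda_m>0$ in each of these cases: $\mu>-1$ and $m\ge0$; $\mu=-1$, $\beta>1$ and $m\ge1$; $\mu=-1$, $\beta=1$, $m\ge2$ and $(\mu,\beta,a,b)$ not exceptional. The function $\lambda_{\beta,\mu}$ is absolutely monotonic and multiplicatively convex on $(0,\infty)$, the latter meaning $\lambda_{\beta,\mu}(x^ty^{1-t})\le\lambda_{\beta,\mu}(x)^t\lambda_{\beta,\mu}(y)^{1-t}$ for $x,y>0$, $t\in[0,1]$.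 3. $y\mapsto\lambda_{\beta,\mu}(1/y)$ is completely monotonic and log-convex on $(0,\infty)$ (log-convexity of a function $F\ge0$ meaning $F(tx+(1-t)y)\le F(x)^tF(y)^{1-t}$, $t\in[0,1]$), and there is a non-negative measure $\tau$ supported on $[0,\infty)$ with $\lambda_{\beta,\mu}(x)=\int_{[0,\infty)}e^{-t/x}\,d\tau(t)$, the integral being convergent, for all $x>0$. 4. Put $Q(x)=\dfrac{g(\mu,x)\,g(1+\beta+\mu,x)}{g(1+\mu,x)\,g(\beta+\mu,x)}$. For $x>0$ the denominator is positive, $\dfrac{\mu}{\beta+\mu}<Q(x)$ if $\mu+\beta>0$, and $Q(x)<1$ if $(\mu,\beta,a,b)$ is not exceptional. For $x=0$, $\mu>-1$, $\mu+\beta>0$ the denominator is positive and $\dfrac{\mu}{\beta+\mu}=Q(0)<1$. 5. For all $x\ge0$, $\lambda_{\beta,\mu}(x)\ge\dfrac{\beta}{\Gamma(\mu+1)\Gamma(\mu+\beta+1)}$, with equality at $x=0$ and, if $(\mu,\beta,a,b)$ is not exceptional, only at $x=0$. -/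

import Mathlib

open Set
open scoped Nat ContDiff

noncomputable section

/-- The product `(a₁)ₙ ⋯ (aₚ)ₙ` of the rising factorials of a list of real parameters
(without regard to order). -/
def risingProd (a : Multiset ℝ) (n : ℕ) : ℝ :=
  (a.map fun t => (ascPochhammer ℝ n).eval t).prod

/-- The `n`-th term of the generalized hypergeometric series `ₚF_q(a; b; x)`. -/
def hypTerm (a b : Multiset ℝ) (x : ℝ) (n : ℕ) : ℝ :=
  risingProd a n / (risingProd b n * (n ! : ℝ)) * x ^ n

/-- The generalized hypergeometric function `ₚF_q(a; b; x)`, `p = card a`, `q = card b`. -/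
def genHyp (a b : Multiset ℝ) (x : ℝ) : ℝ := ∑' n, hypTerm a b x n

/-- The `n`-th term of the series of `Γ(ν)⁻¹ ₚF_{q+1}(a; ν, b; x)`; because
`Γ(ν) (ν)ₙ = Γ(ν + n)` it makes sense for every real `ν`. (`Real.Gamma` takes the value `0` at
`0, -1, -2, …`, hence `1 / Γ` has its true value `0` there.) -/
def normHypTerm (a b : Multiset ℝ) (ν x : ℝ) (n : ℕ) : ℝ :=
  hypTerm a b x n * (Real.Gamma (ν + n))⁻¹

/-- The function `g(ν, x) = Γ(ν)⁻¹ ₚF_{q+1}(a; ν, b; x)`, extended by continuity to the points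
`ν = 0, -1, -2, …`. -/
def normHyp (a b : Multiset ℝ) (ν x : ℝ) : ℝ := ∑' n, normHypTerm a b ν x n

/-- `λ_{β,μ}(x) = g(μ+1,x) g(μ+β,x) - g(μ,x) g(μ+β+1,x)`. -/
def hypTuranian (a b : Multiset ℝ) (β μ x : ℝ) : ℝ :=
  normHyp a b (μ + 1) x * normHyp a b (μ + β) x - normHyp a b μ x * normHyp a b (μ + β + 1) x

/-- With `p = card a ≤ q = card b` and `r = q - p`, the chain of inequalities
`e_q(b)/e_p(a) ≤ e_{q-1}(b)/e_{p-1}(a) ≤ ⋯ ≤ e_{r+1}(b)/e_1(a) ≤ e_r(b)`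
between quotients of elementary symmetric polynomials. It is empty if `p = 0`. -/
def SymmChain (a b : Multiset ℝ) : Prop :=
  ∀ j < a.card,
    b.esymm (j + 1 + (b.card - a.card)) / a.esymm (j + 1) ≤
      b.esymm (j + (b.card - a.card)) / a.esymm j

/-- `f` is positive, continuous and strictly discrete Wright log-concave on the interval `I`. -/
def StrictDiscreteWrightLogConcaveOn (f : ℝ → ℝ) (I : Set ℝ) : Prop :=
  (∀ μ ∈ I, 0 < f μ) ∧ ContinuousOn f I ∧
    ∀ h : ℕ, 1 ≤ h → ∀ s : ℝ, 0 < s → ∀ μ : ℝ, μ ∈ I → μ + h + s ∈ I →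
      0 < f (μ + h) * f (μ + s) - f μ * f (μ + h + s)

/-- Multiplicative convexity of a nonnegative function on a set `s` of positive numbers. -/
def MultiplicativelyConvexOn (f : ℝ → ℝ) (s : Set ℝ) : Prop :=
  (∀ x ∈ s, 0 ≤ f x) ∧ ∀ x ∈ s, ∀ y ∈ s, ∀ t ∈ Icc (0 : ℝ) 1,
    f (x ^ t * y ^ (1 - t)) ≤ f x ^ t * f y ^ (1 - t)

/-- Log-convexity of a nonnegative function on a convex set `s`. -/
def LogConvexOn (f : ℝ → ℝ) (s : Set ℝ) : Prop :=
  (∀ x ∈ s, 0 ≤ f x) ∧ ∀ x ∈ s, ∀ y ∈ s, ∀ t ∈ Icc (0 : ℝ) 1,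
    f (t * x + (1 - t) * y) ≤ f x ^ t * f y ^ (1 - t)

/-- Complete monotonicity: `(-1)ⁿ f⁽ⁿ⁾ ≥ 0` for all `n`. -/
def CompletelyMonotoneOn (f : ℝ → ℝ) (s : Set ℝ) : Prop :=
  ContDiffOn ℝ ∞ f s ∧ ∀ n : ℕ, ∀ x ∈ s, 0 ≤ (-1 : ℝ) ^ n * iteratedDerivWithin n f s x

end

/-!
Write `h n` for the coefficient of `x ^ n` in `ₚF_q(a; b; x)`, so that
`g (ν, x) = ∑ h n * x ^ n / Γ (ν + n)`.

The ratio `h (n + 1) / h n` is the value at `n` of the rational function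
`∏ (a i + x) / ((1 + x) * ∏ (b j + x))`. By Vieta's formulas the hypothesis on the elementary
symmetric polynomials says that the quotients of the coefficients of numerator and denominator
decrease with the degree, which makes the rational function decrease on `[0, ∞)`, strictly unless
numerator and denominator coincide (`SymmChain.shiftProd_cross`,
`SymmChain.shiftProd_cross_strict`). Hence `h` is a positive log-concave sequence; nothing else about
`h` is used, apart from the strictness in one borderline case.

By `1 / Γ (z) = z / Γ (z + 1)` the coefficient of `x ^ m` in the Turanian is the sum over
`k + l = m` of `h k * h l * T k l` with
`T k l = (l - k + β) / (Γ (k + μ + 1) * Γ (l + μ + β + 1))`. The sum of the `T k l` alone telescopes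
and has an evident sign (`sum_turanTerm`, `sum_turanTerm_pos`). The symmetrized terms
`T k l + T l k` change sign at most once, from minus to plus, when `k` moves from `0` to `m / 2`
(`turanTerm_symm_step`), while log-concavity makes the weights `h k * h l` increase in the same
direction. A Chebyshev-type argument (`exists_sub_mul_nonneg`) therefore bounds the coefficient
below by a positive multiple of the telescoping sum. This gives the claimed positivity except for
`μ = -1`, `β = 1`, where the telescoping sum vanishes and the strict decrease of `h (n + 1) / h n`
is used instead (`IsLogConcaveSeq.turanCoeff_neg_one_one_pos`). The lower bound for the quotient
comes from a similar expansion whose symmetrized terms are all nonnegative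
(`ratioTerm_symm_nonneg`).

The remaining assertions hold for every everywhere convergent power series `F` with nonnegative
coefficients. Such functions are closed under differentiation, which gives absolute monotonicity;
functions `y ↦ F (1 / y)` are closed under `f ↦ -f'`, which gives complete monotonicity;
multiplicative convexity is Hölder's inequality, and log-convexity of `y ↦ F (1 / y)` follows from
it; and for `m ≥ 1` the power `x ^ m` is the Laplace transform of `t ^ (m - 1) / (m - 1)!` at
`1 / x`, which gives the measure.
Strict discrete Wright log-concavity is the positivity of the Turanian, iterated.
-/

/-! ### Entire power series with nonnegative coefficients -/

/-- `F` is the sum of a power series with nonnegative coefficients that converges on all of `ℝ`. -/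
def HasNonnegPowerSeries (F : ℝ → ℝ) : Prop :=
  ∃ c : ℕ → ℝ, (∀ m, 0 ≤ c m) ∧ ∀ x : ℝ, HasSum (fun m => c m * x ^ m) (F x)

namespace HasNonnegPowerSeries

variable {F : ℝ → ℝ}

theorem nonneg (h : HasNonnegPowerSeries F) {x : ℝ} (hx : 0 ≤ x) : 0 ≤ F x := by
  obtain ⟨c, hc, hs⟩ := h
  exact (hs x).nonneg fun m => mul_nonneg (hc m) (pow_nonneg hx m)

theorem monotone (h : HasNonnegPowerSeries F) {x y : ℝ} (hx : 0 ≤ x) (hxy : x ≤ y) :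
    F x ≤ F y := by
  obtain ⟨c, hc, hs⟩ := h
  exact hasSum_le (fun m => mul_le_mul_of_nonneg_left (pow_le_pow_left₀ hx hxy m) (hc m))
    (hs x) (hs y)

theorem exists_hasDerivAt (h : HasNonnegPowerSeries F) :
    ∃ G, HasNonnegPowerSeries G ∧ ∀ x, HasDerivAt F (G x) x := by
  obtain ⟨c, hc, hs⟩ := h
  -- On `|y| < r` with `1 ≤ r` the differentiated terms are dominated by `c m * (2 * r) ^ m`,
  -- because `m ≤ 2 ^ m`.
  have hbound : ∀ r : ℝ, 1 ≤ r → ∀ m : ℕ, ∀ y ∈ Metric.ball (0 : ℝ) r,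
      ‖c m * (m * y ^ (m - 1))‖ ≤ c m * (2 * r) ^ m := by
    intro r hr m y hy
    have hy' : |y| ≤ r := by
      have := Metric.mem_ball.1 hy
      rw [Real.dist_eq, sub_zero] at this
      exact this.le
    rw [norm_mul, Real.norm_of_nonneg (hc m), norm_mul, norm_pow, Real.norm_eq_abs,
      Real.norm_eq_abs, Nat.abs_cast, mul_pow]
    refine mul_le_mul_of_nonneg_left (mul_le_mul ?_ ?_ (by positivity) (by positivity)) (hc m)
    · exact_mod_cast Nat.lt_two_pow_self.le
    · exact (pow_le_pow_left₀ (abs_nonneg y) hy' _).trans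
        (pow_le_pow_right₀ hr (Nat.sub_le m 1))
  have key : ∀ x : ℝ, Summable (fun m : ℕ => c m * (m * x ^ (m - 1))) ∧
      HasDerivAt F (∑' m : ℕ, c m * (m * x ^ (m - 1))) x := by
    intro x
    have hr : (1 : ℝ) ≤ |x| + 1 := by linarith [abs_nonneg x]
    have hmem : x ∈ Metric.ball (0 : ℝ) (|x| + 1) := by
      rw [Metric.mem_ball, Real.dist_eq, sub_zero]; linarith
    have hsum := (hs (2 * (|x| + 1))).summable
    refine ⟨hsum.of_norm_bounded fun m => hbound _ hr m x hmem, ?_⟩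
    have hd := hasDerivAt_tsum_of_isPreconnected (g := fun m y => c m * y ^ m)
      (g' := fun m y => c m * (m * y ^ (m - 1))) hsum
      Metric.isOpen_ball (convex_ball (0 : ℝ) (|x| + 1)).isPreconnected
      (fun m y _ => (hasDerivAt_pow m y).const_mul (c m)) (hbound _ hr) hmem
      (hs x).summable hmem
    have hF : F = fun y => ∑' m, c m * y ^ m := funext fun y => (hs y).tsum_eq.symm
    rw [hF]
    exact hd
  refine ⟨_, ⟨fun m => c (m + 1) * (m + 1 : ℕ), fun m => mul_nonneg (hc _) (Nat.cast_nonneg _),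
    fun x => ?_⟩, fun x => (key x).2⟩
  have h1 := (hasSum_nat_add_iff' 1).2 (key x).1.hasSum
  simpa [mul_assoc] using h1

theorem sq_mul (h : HasNonnegPowerSeries F) : HasNonnegPowerSeries fun x => x ^ 2 * F x := by
  obtain ⟨c, hc, hs⟩ := h
  refine ⟨fun m => if m < 2 then 0 else c (m - 2), fun m => ?_, fun x => ?_⟩
  · dsimp only
    split_ifs
    exacts [le_rfl, hc _]
  · rw [← hasSum_nat_add_iff' 2]
    have h1 := (hs x).mul_left (x ^ 2)
    simpa [Finset.sum_range_succ, pow_add, mul_comm, mul_left_comm, mul_assoc] using h1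

theorem differentiable (h : HasNonnegPowerSeries F) : Differentiable ℝ F := by
  obtain ⟨G, -, hG⟩ := h.exists_hasDerivAt
  exact fun x => (hG x).differentiableAt

theorem iteratedDeriv (h : HasNonnegPowerSeries F) (n : ℕ) :
    HasNonnegPowerSeries (iteratedDeriv n F) := by
  induction n generalizing F with
  | zero => simpa using h
  | succ n ih =>
    obtain ⟨G, hG, hd⟩ := h.exists_hasDerivAt
    rw [iteratedDeriv_succ', show deriv F = G from funext fun x => (hd x).deriv]
    exact ih hG

theorem absolutelyMonotoneOn (h : HasNonnegPowerSeries F) : AbsolutelyMonotoneOn F (Ioi 0) :=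
  .of_contDiff
    (contDiff_of_differentiable_iteratedDeriv fun m _ => (h.iteratedDeriv m).differentiable)
    fun n _ hx => (h.iteratedDeriv n).nonneg (le_of_lt hx)

/-- The class of functions `y ↦ F (1 / y)` is closed under `f ↦ -f'`: the derivative of
`y ↦ F (1 / y)` is `y ↦ -G (1 / y)` with `G x = x ^ 2 * F' x`. -/
theorem exists_iteratedDerivWithin_one_div (h : HasNonnegPowerSeries F) (n : ℕ) :
    ∃ G, HasNonnegPowerSeries G ∧
      ∀ y ∈ Ioi (0 : ℝ), iteratedDerivWithin n (fun y => F (1 / y)) (Ioi 0) y =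
        (-1) ^ n * G (1 / y) := by
  induction n with
  | zero => exact ⟨F, h, fun y _ => by simp⟩
  | succ n ih =>
    obtain ⟨G, hG, he⟩ := ih
    obtain ⟨K, hK, hd⟩ := hG.exists_hasDerivAt
    refine ⟨_, hK.sq_mul, fun y hy => ?_⟩
    have hy0 : y ≠ 0 := ne_of_gt hy
    rw [iteratedDerivWithin_succ, derivWithin_congr he (he y hy),
      derivWithin_of_isOpen isOpen_Ioi hy]
    have h1 : HasDerivAt (fun y : ℝ => 1 / y) (-(1 / y) ^ 2) y := by
      simpa [one_div, inv_pow] using hasDerivAt_inv hy0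
    have h2 := ((hd (1 / y)).comp y h1).const_mul ((-1 : ℝ) ^ n)
    refine h2.deriv.trans ?_
    ring

theorem completelyMonotoneOn_one_div (h : HasNonnegPowerSeries F) :
    CompletelyMonotoneOn (fun y => F (1 / y)) (Ioi 0) := by
  refine ⟨contDiffOn_of_differentiableOn_deriv fun m _ => ?_, fun n y hy => ?_⟩
  · obtain ⟨G, hG, he⟩ := h.exists_iteratedDerivWithin_one_div m
    refine DifferentiableOn.congr (fun y hy => ?_) he
    have hy0 : y ≠ 0 := ne_of_gt hy
    refine (DifferentiableAt.const_mul ?_ _).differentiableWithinAt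
    exact (hG.differentiable _).comp y (by fun_prop (disch := assumption))
  · obtain ⟨G, hG, he⟩ := h.exists_iteratedDerivWithin_one_div n
    rw [he y hy, ← mul_assoc, ← mul_pow]
    simpa using hG.nonneg (x := 1 / y) (one_div_nonneg.2 (le_of_lt hy))

/-- Hölder's inequality for the coefficients, obtained by applying the weighted arithmetic-geometric
mean inequality to the normalized terms `c m * x ^ m / F x` and `c m * y ^ m / F y`. -/
theorem multiplicativelyConvexOn (h : HasNonnegPowerSeries F) :
    MultiplicativelyConvexOn F (Ioi 0) := by
  refine ⟨fun x hx => h.nonneg (le_of_lt hx), fun x hx y hy t ht => ?_⟩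
  rw [mem_Ioi] at hx hy
  have hnx := h.nonneg hx.le
  have hny := h.nonneg hy.le
  obtain ⟨c, hc, hs⟩ := h
  have ht' : 0 ≤ 1 - t := sub_nonneg.2 ht.2
  -- If `F` vanishes at a positive point, all coefficients vanish.
  have hzero : ∀ z : ℝ, 0 < z → F z = 0 → ∀ w, F w = 0 := by
    intro z hz hF w
    have h0 := hs z
    rw [hF, hasSum_zero_iff_of_nonneg fun m => mul_nonneg (hc m) (pow_nonneg hz.le m)] at h0
    have hc0 : ∀ m, c m = 0 := fun m => by
      have := congrFun h0 m
      simpa [hz.ne'] using this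
    have hw := hs w
    simp only [hc0, zero_mul] at hw
    exact hw.unique hasSum_zero
  rcases hnx.eq_or_lt with hx0 | hx0
  · rw [hzero x hx hx0.symm]; positivity
  rcases hny.eq_or_lt with hy0 | hy0
  · rw [hzero y hy hy0.symm]; positivity
  have hle : ∀ m, c m * (x ^ t * y ^ (1 - t)) ^ m ≤
      F x ^ t * F y ^ (1 - t) * (t * (c m * x ^ m / F x) + (1 - t) * (c m * y ^ m / F y)) := by
    intro m
    have hP : 0 ≤ c m * x ^ m / F x := by have := hc m; positivity
    have hQ : 0 ≤ c m * y ^ m / F y := by have := hc m; positivity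
    refine le_trans (le_of_eq ?_) (mul_le_mul_of_nonneg_left
      (Real.geom_mean_le_arith_mean2_weighted ht.1 ht' hP hQ (by ring)) (by positivity))
    have hxt : 0 < F x ^ t := Real.rpow_pos_of_pos hx0 t
    have hyt : 0 < F y ^ (1 - t) := Real.rpow_pos_of_pos hy0 _
    rw [Real.div_rpow (by have := hc m; positivity) hx0.le,
      Real.div_rpow (by have := hc m; positivity) hy0.le,
      Real.mul_rpow (hc m) (by positivity), Real.mul_rpow (hc m) (by positivity),
      ← Real.rpow_natCast_mul hx.le, ← Real.rpow_natCast_mul hy.le, mul_pow,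
      ← Real.rpow_mul_natCast hx.le, ← Real.rpow_mul_natCast hy.le]
    have hcc : c m ^ t * c m ^ (1 - t) = c m := by
      rw [← Real.rpow_add' (hc m) (by norm_num)]; norm_num
    field_simp
    exact hcc.symm
  have hsum := hasSum_le hle (hs (x ^ t * y ^ (1 - t)))
    (((((hs x).div_const (F x)).mul_left t).add
      (((hs y).div_const (F y)).mul_left (1 - t))).mul_left (F x ^ t * F y ^ (1 - t)))
  simpa [div_self hx0.ne', div_self hy0.ne'] using hsum

theorem logConvexOn_one_div (h : HasNonnegPowerSeries F) :
    LogConvexOn (fun y => F (1 / y)) (Ioi 0) := by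
  refine ⟨fun y hy => h.nonneg (one_div_nonneg.2 (le_of_lt hy)), fun x hx y hy t ht => ?_⟩
  rw [mem_Ioi] at hx hy
  refine le_trans ?_ (h.multiplicativelyConvexOn.2 (1 / x) (one_div_pos.2 hx) (1 / y)
    (one_div_pos.2 hy) t ht)
  have hg := Real.geom_mean_le_arith_mean2_weighted ht.1 (sub_nonneg.2 ht.2) hx.le hy.le (by ring)
  have hpos : 0 < x ^ t * y ^ (1 - t) :=
    mul_pos (Real.rpow_pos_of_pos hx _) (Real.rpow_pos_of_pos hy _)
  refine h.monotone (one_div_nonneg.2 (hpos.le.trans hg)) ?_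
  rw [Real.div_rpow zero_le_one hx.le, Real.div_rpow zero_le_one hy.le, Real.one_rpow,
    Real.one_rpow, div_mul_div_comm, one_mul]
  exact one_div_le_one_div_of_le hpos hg

open MeasureTheory in
/-- A power series with nonnegative coefficients is a Laplace transform in the variable `1 / x`:
`x ^ m` is the transform of `t ^ (m - 1) / (m - 1)!` for `m ≥ 1` and of the Dirac mass at `0` for
`m = 0`. -/
theorem exists_measure_laplace (h : HasNonnegPowerSeries F) :
    ∃ τ : Measure ℝ, τ (Iio 0) = 0 ∧ ∀ x : ℝ, 0 < x →
      Integrable (fun t => Real.exp (-t / x)) τ ∧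
      F x = ∫ t in Ici (0 : ℝ), Real.exp (-t / x) ∂τ := by
  have hpow : ∀ m : ℕ, ∃ τ : Measure ℝ, τ (Iio 0) = 0 ∧ ∀ x : ℝ, 0 < x →
      ∫⁻ t, ENNReal.ofReal (Real.exp (-t / x)) ∂τ = ENNReal.ofReal (x ^ m) := by
    rintro (_ | m)
    · refine ⟨Measure.dirac 0, by simp, fun x _ => ?_⟩
      rw [lintegral_dirac' _ (by fun_prop)]
      simp
    · refine ⟨volume.withDensity fun t => ENNReal.ofReal
        (if 0 ≤ t then t ^ m / (m ! : ℝ) else 0), ?_, fun x hx => ?_⟩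
      · rw [withDensity_apply _ measurableSet_Iio]
        refine (setLIntegral_congr_fun (g := fun _ => 0) measurableSet_Iio fun t ht => ?_).trans
          (by simp)
        simp [not_le.2 (mem_Iio.1 ht)]
      · have hmeas : Measurable fun t : ℝ => ENNReal.ofReal
            (if 0 ≤ t then t ^ m / (m ! : ℝ) else 0) :=
          (Measurable.ite measurableSet_Ici (by fun_prop) measurable_const).ennreal_ofReal
        rw [lintegral_withDensity_eq_lintegral_mul _ hmeas (by fun_prop)]
        have hone := ProbabilityTheory.lintegral_gammaPDF_eq_one (a := m + 1) (r := 1 / x)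
          (by positivity) (by positivity)
        calc _ = ∫⁻ t, ENNReal.ofReal (x ^ (m + 1)) *
                ProbabilityTheory.gammaPDF (m + 1) (1 / x) t := by
              refine lintegral_congr fun t => ?_
              rw [ProbabilityTheory.gammaPDF, ProbabilityTheory.gammaPDFReal, Pi.mul_apply]
              by_cases ht : 0 ≤ t
              · rw [if_pos ht, if_pos ht, ← ENNReal.ofReal_mul (by positivity),
                  ← ENNReal.ofReal_mul (by positivity), Real.Gamma_nat_eq_factorial,
                  add_sub_cancel_right, Real.rpow_natCast]
                congr 1
                have : ((1 / x : ℝ) ^ ((m : ℝ) + 1)) = 1 / x ^ (m + 1) := by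
                  rw [← Nat.cast_succ, Real.rpow_natCast, one_div_pow]
                rw [this, show -t / x = -(1 / x * t) by ring]
                field_simp
              · simp [ht]
          _ = _ := by
              have hm : Measurable (ProbabilityTheory.gammaPDF (m + 1) (1 / x)) :=
                (ProbabilityTheory.measurable_gammaPDFReal _ _).ennreal_ofReal
              rw [lintegral_const_mul _ hm, hone, mul_one]
  choose τ hτ0 hτ using hpow
  obtain ⟨c, hc, hs⟩ := h
  refine ⟨Measure.sum fun m => ENNReal.ofReal (c m) • τ m, ?_, fun x hx => ?_⟩
  · rw [Measure.sum_apply _ measurableSet_Iio]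
    simp [hτ0]
  · set T := Measure.sum fun m => ENNReal.ofReal (c m) • τ m with hT
    have hl : ∫⁻ t, ENNReal.ofReal (Real.exp (-t / x)) ∂T = ENNReal.ofReal (F x) := by
      rw [hT, lintegral_sum_measure, ← (hs x).tsum_eq, ENNReal.ofReal_tsum_of_nonneg
        (fun m => mul_nonneg (hc m) (pow_nonneg hx.le m)) (hs x).summable]
      refine tsum_congr fun m => ?_
      rw [lintegral_smul_measure, hτ m x hx, ENNReal.ofReal_mul (hc m), smul_eq_mul]
    have hmeas : AEStronglyMeasurable (fun t => Real.exp (-t / x)) T :=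
      (by fun_prop : Continuous fun t : ℝ => Real.exp (-t / x)).aestronglyMeasurable
    have hT0 : T (Iio 0) = 0 := by
      rw [hT, Measure.sum_apply _ measurableSet_Iio]; simp [hτ0]
    refine ⟨⟨hmeas, ?_⟩, ?_⟩
    · rw [hasFiniteIntegral_iff_ofReal (.of_forall fun t => (Real.exp_pos _).le), hl]
      exact ENNReal.ofReal_lt_top
    · have hr : T.restrict (Ici 0) = T := by
        refine Measure.restrict_eq_self_of_ae_mem ?_
        rw [ae_iff]
        simpa [Iio] using hT0
      rw [hr, integral_eq_lintegral_of_nonneg_ae (.of_forall fun t => (Real.exp_pos _).le) hmeas,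
        hl, ENNReal.toReal_ofReal]
      exact (hs x).nonneg fun m => mul_nonneg (hc m) (pow_nonneg hx.le m)

end HasNonnegPowerSeries

/-! ### Quotients of polynomials with monotone coefficient ratios -/

/-- If the quotients `n i / d i` decrease with `i`, then the quotient of the polynomials
`∑ n i x ^ i` and `∑ d i x ^ i` decreases on `[0, ∞)`: twice the difference of the two sides is
`∑ i, ∑ j, (n i * d j - n j * d i) * (x ^ i * y ^ j - y ^ i * x ^ j)`, where both factors are
nonnegative for `i ≤ j` and nonpositive for `j ≤ i`. -/
theorem sum_mul_sum_pow_cross (n d : ℕ → ℝ) (q : ℕ)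
    (h : ∀ i j, i < j → j ≤ q → n j * d i ≤ n i * d j) {x y : ℝ} (hx : 0 ≤ x) (hxy : x ≤ y) :
    (n 0 * d q - n q * d 0) * (y ^ q - x ^ q) ≤
      (∑ i ∈ Finset.range (q + 1), n i * x ^ i) * (∑ i ∈ Finset.range (q + 1), d i * y ^ i) -
      (∑ i ∈ Finset.range (q + 1), n i * y ^ i) * (∑ i ∈ Finset.range (q + 1), d i * x ^ i) := by
  set G : ℕ → ℕ → ℝ := fun i j => (n i * d j - n j * d i) * (x ^ i * y ^ j - y ^ i * x ^ j) with hG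
  have hsymm : ∀ i j, G i j = G j i := fun i j => by simp only [hG]; ring
  have hlt : ∀ i j, i < j → j ≤ q → 0 ≤ G i j := by
    intro i j hij hj
    refine mul_nonneg (sub_nonneg.2 (h i j hij hj)) (sub_nonneg.2 ?_)
    obtain ⟨k, rfl⟩ := Nat.exists_eq_add_of_lt hij
    have := pow_le_pow_left₀ hx hxy (k + 1)
    calc y ^ i * x ^ (i + k + 1) = y ^ i * x ^ i * x ^ (k + 1) := by ring
      _ ≤ y ^ i * x ^ i * y ^ (k + 1) :=
        mul_le_mul_of_nonneg_left this (mul_nonneg (pow_nonneg (hx.trans hxy) _) (pow_nonneg hx _))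
      _ = _ := by ring
  have hnn : ∀ i ≤ q, ∀ j ≤ q, 0 ≤ G i j := by
    intro i hi j hj
    rcases lt_trichotomy i j with hij | rfl | hij
    · exact hlt i j hij hj
    · simp [hG]
    · rw [hsymm]; exact hlt j i hij hi
  have hsum : 2 * ((∑ i ∈ Finset.range (q + 1), n i * x ^ i) *
        (∑ i ∈ Finset.range (q + 1), d i * y ^ i) -
      (∑ i ∈ Finset.range (q + 1), n i * y ^ i) * (∑ i ∈ Finset.range (q + 1), d i * x ^ i)) =
      ∑ i ∈ Finset.range (q + 1), ∑ j ∈ Finset.range (q + 1), G i j := by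
    have e1 : ∀ u v : ℝ, (∑ i ∈ Finset.range (q + 1), n i * u ^ i) *
        (∑ i ∈ Finset.range (q + 1), d i * v ^ i) =
        ∑ i ∈ Finset.range (q + 1), ∑ j ∈ Finset.range (q + 1), n i * u ^ i * (d j * v ^ j) :=
      fun u v => Finset.sum_mul_sum _ _ _ _
    have e2 : ∀ u v : ℝ, (∑ i ∈ Finset.range (q + 1), n i * u ^ i) *
        (∑ i ∈ Finset.range (q + 1), d i * v ^ i) =
        ∑ i ∈ Finset.range (q + 1), ∑ j ∈ Finset.range (q + 1), n j * u ^ j * (d i * v ^ i) :=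
      fun u v => (e1 u v).trans Finset.sum_comm
    have e3 : ∀ A B : ℝ, 2 * (A - B) = A + A - (B + B) := fun A B => by ring
    rw [e3]
    nth_rewrite 1 [e1 x y]
    nth_rewrite 1 [e2 x y]
    nth_rewrite 1 [e1 y x]
    nth_rewrite 1 [e2 y x]
    simp only [← Finset.sum_add_distrib, ← Finset.sum_sub_distrib]
    refine Finset.sum_congr rfl fun i _ => Finset.sum_congr rfl fun j _ => ?_
    simp only [hG]; ring
  -- Only the two equal terms with indices `(0, q)` and `(q, 0)` are kept.
  have hkeep : 2 * G 0 q ≤ ∑ i ∈ Finset.range (q + 1), ∑ j ∈ Finset.range (q + 1), G i j := by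
    have hrow : ∀ i ≤ q, ∀ j ≤ q, G i j ≤ ∑ j ∈ Finset.range (q + 1), G i j := fun i hi j hj =>
      Finset.single_le_sum (f := fun j => G i j)
        (fun k hk => hnn i hi k (Nat.lt_succ_iff.1 (Finset.mem_range.1 hk)))
        (Finset.mem_range.2 (Nat.lt_succ_iff.2 hj))
    rcases Nat.eq_zero_or_pos q with rfl | hq
    · simp [hG]
    · calc 2 * G 0 q = ∑ i ∈ ({0, q} : Finset ℕ), G i (q - i) := by
            rw [Finset.sum_pair hq.ne, Nat.sub_self, Nat.sub_zero, hsymm q 0]; ring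
        _ ≤ ∑ i ∈ ({0, q} : Finset ℕ), ∑ j ∈ Finset.range (q + 1), G i j :=
          Finset.sum_le_sum fun i hi => hrow i (by
            rcases Finset.mem_insert.1 hi with h | h
            · omega
            · exact (Finset.mem_singleton.1 h).le) _ (Nat.sub_le _ _)
        _ ≤ _ := Finset.sum_le_sum_of_subset_of_nonneg (by
            intro i hi
            rcases Finset.mem_insert.1 hi with h | h
            · simp [h]
            · simp [Finset.mem_singleton.1 h]) fun i hi _ => Finset.sum_nonneg fun j hj =>
              hnn i (Nat.lt_succ_iff.1 (Finset.mem_range.1 hi)) j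
                (Nat.lt_succ_iff.1 (Finset.mem_range.1 hj))
  have hG0 : G 0 q = (n 0 * d q - n q * d 0) * (y ^ q - x ^ q) := by simp [hG]
  linarith [hkeep, hsum, hG0]

/-! ### Elementary symmetric polynomials and the ratio of consecutive coefficients -/

/-- The product `∏ (t + x)` over the elements `t` of `a`. -/
noncomputable def shiftProd (a : Multiset ℝ) (x : ℝ) : ℝ := (a.map fun t => t + x).prod

theorem shiftProd_pos {a : Multiset ℝ} (ha : ∀ t ∈ a, 0 < t) {x : ℝ} (hx : 0 ≤ x) :
    0 < shiftProd a x := by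
  refine Multiset.prod_pos fun t ht => ?_
  obtain ⟨s, hs, rfl⟩ := Multiset.mem_map.1 ht
  have := ha s hs
  positivity

theorem esymm_pos {a : Multiset ℝ} (ha : ∀ t ∈ a, 0 < t) {k : ℕ} (hk : k ≤ a.card) :
    0 < a.esymm k := by
  have hpos : ∀ s ∈ a.powersetCard k, 0 < s.prod := fun s hs =>
    Multiset.prod_pos fun t ht => ha t (Multiset.mem_of_le (Multiset.mem_powersetCard.1 hs).1 ht)
  obtain ⟨s, hmem⟩ := Multiset.card_pos_iff_exists_mem.1
    (show 0 < (a.powersetCard k).card by rw [Multiset.card_powersetCard]; exact Nat.choose_pos hk)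
  rw [Multiset.esymm]
  refine lt_of_lt_of_le (hpos s hmem) (Multiset.single_le_sum ?_ _ (Multiset.mem_map_of_mem _ hmem))
  intro x hx
  obtain ⟨u, hu, rfl⟩ := Multiset.mem_map.1 hx
  exact (hpos u hu).le

theorem multiset_esymm_zero (a : Multiset ℝ) : a.esymm 0 = 1 := by
  simp [Multiset.esymm]

theorem shiftProd_eq_sum (a : Multiset ℝ) (x : ℝ) {q : ℕ} (hq : a.card ≤ q) :
    shiftProd a x = ∑ i ∈ Finset.range (q + 1),
      (if i ≤ a.card then a.esymm (a.card - i) else 0) * x ^ i := by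
  have h := congrArg (Polynomial.eval x) (Multiset.prod_X_add_C_eq_sum_esymm a)
  rw [Polynomial.eval_multiset_prod, Polynomial.eval_finsetSum, Multiset.map_map] at h
  have h1 : shiftProd a x = ∑ j ∈ Finset.range (a.card + 1), a.esymm j * x ^ (a.card - j) := by
    simpa [shiftProd, Function.comp_def, add_comm] using h
  rw [h1, ← Finset.sum_range_reflect,
    ← Finset.sum_subset (Finset.range_subset_range.2 (Nat.succ_le_succ hq))]
  · refine Finset.sum_congr rfl fun i hi => ?_
    have : i ≤ a.card := Nat.lt_succ_iff.1 (Finset.mem_range.1 hi)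
    rw [if_pos this, show a.card + 1 - 1 - i = a.card - i by omega, Nat.sub_sub_self this]
  · intro i _ hi
    rw [if_neg (by simpa using hi), zero_mul]

theorem eq_of_esymm_eq {a b : Multiset ℝ} (hc : a.card = b.card)
    (h : ∀ j ≤ a.card, a.esymm j = b.esymm j) : a = b := by
  rw [← Polynomial.roots_multiset_prod_X_sub_C a, ← Polynomial.roots_multiset_prod_X_sub_C b,
    Multiset.prod_X_sub_X_eq_sum_esymm, Multiset.prod_X_sub_X_eq_sum_esymm, hc]
  congr 1
  refine Finset.sum_congr rfl fun j hj => ?_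
  rw [h j (by rw [hc]; exact Nat.lt_succ_iff.1 (Finset.mem_range.1 hj))]

section Chain

variable {a B : Multiset ℝ}

theorem SymmChain.antitone (h : SymmChain a B) {J K : ℕ} (hJK : J ≤ K) (hK : K ≤ a.card) :
    B.esymm (K + (B.card - a.card)) / a.esymm K ≤ B.esymm (J + (B.card - a.card)) / a.esymm J := by
  induction K, hJK using Nat.le_induction with
  | base => exact le_rfl
  | succ K _ ih => exact (h K hK).trans (ih (by omega))

/-- The chain of inequalities says that the quotients of the coefficients of `∏ (a i + x)` and
`∏ (B j + x)` decrease with the degree. -/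
theorem SymmChain.cross (h : SymmChain a B) (ha : ∀ t ∈ a, 0 < t) (hB : ∀ t ∈ B, 0 < t)
    (hcard : a.card ≤ B.card) (i j : ℕ) (hij : i < j) (hj : j ≤ B.card) :
    (if j ≤ a.card then a.esymm (a.card - j) else 0) *
        (if i ≤ B.card then B.esymm (B.card - i) else 0) ≤
      (if i ≤ a.card then a.esymm (a.card - i) else 0) *
        (if j ≤ B.card then B.esymm (B.card - j) else 0) := by
  rw [if_pos hj, if_pos (hij.le.trans hj)]
  by_cases hja : j ≤ a.card
  · rw [if_pos hja, if_pos (hij.le.trans hja)]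
    have := h.antitone (J := a.card - j) (K := a.card - i) (by omega) (by omega)
    rw [show a.card - i + (B.card - a.card) = B.card - i by omega,
      show a.card - j + (B.card - a.card) = B.card - j by omega,
      div_le_div_iff₀ (esymm_pos ha (by omega)) (esymm_pos ha (by omega))] at this
    linarith
  · rw [if_neg hja, zero_mul]
    refine mul_nonneg ?_ (esymm_pos hB (by omega)).le
    split_ifs
    exacts [(esymm_pos ha (by omega)).le, le_rfl]

/-- Unless `∏ (a i + x)` and `∏ (B j + x)` coincide, the quotient of their constant coefficients
strictly exceeds the quotient of their coefficients of degree `card B`. -/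
theorem SymmChain.cross_strict (h : SymmChain a B) (ha : ∀ t ∈ a, 0 < t)
    (hcard : a.card ≤ B.card) (hne : a ≠ B) :
    (if B.card ≤ a.card then a.esymm (a.card - B.card) else 0) * B.esymm B.card <
      a.esymm a.card := by
  by_cases hBa : B.card ≤ a.card
  · have hc : a.card = B.card := le_antisymm hcard hBa
    rw [if_pos hBa, Nat.sub_eq_zero_of_le hcard, multiset_esymm_zero, one_mul]
    by_contra! hle
    refine hne (eq_of_esymm_eq hc fun j hj => ?_)
    have h1 := h.antitone (J := 0) (K := j) (Nat.zero_le _) hj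
    have h2 := h.antitone (J := j) (K := a.card) hj le_rfl
    simp only [hc, Nat.sub_self, Nat.add_zero, multiset_esymm_zero, div_one] at h1 h2 hj hle
    have hpos : 0 < a.esymm j := esymm_pos ha (by omega)
    have h3 : 1 ≤ B.esymm B.card / a.esymm B.card := by
      rwa [one_le_div (esymm_pos ha hc.ge)]
    have h4 : B.esymm j / a.esymm j = 1 := le_antisymm h1 (h3.trans h2)
    rw [div_eq_one_iff_eq hpos.ne'] at h4
    exact h4.symm
  · rw [if_neg hBa, zero_mul]
    exact esymm_pos ha le_rfl

theorem SymmChain.shiftProd_cross (h : SymmChain a B) (ha : ∀ t ∈ a, 0 < t) (hB : ∀ t ∈ B, 0 < t)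
    (hcard : a.card ≤ B.card) {x y : ℝ} (hx : 0 ≤ x) (hxy : x ≤ y) :
    shiftProd a y / shiftProd B y ≤ shiftProd a x / shiftProd B x := by
  have hc := sum_mul_sum_pow_cross
    (fun i => if i ≤ a.card then a.esymm (a.card - i) else 0)
    (fun i => if i ≤ B.card then B.esymm (B.card - i) else 0) B.card
    (h.cross ha hB hcard) hx hxy
  rw [← shiftProd_eq_sum a x hcard, ← shiftProd_eq_sum a y hcard, ← shiftProd_eq_sum B x le_rfl,
    ← shiftProd_eq_sum B y le_rfl] at hc
  rw [div_le_div_iff₀ (shiftProd_pos hB (hx.trans hxy)) (shiftProd_pos hB hx)]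
  rcases Nat.eq_zero_or_pos B.card with h0 | h0
  · have h1 : B = 0 := Multiset.card_eq_zero.1 h0
    have h2 : a = 0 := Multiset.card_eq_zero.1 (by omega)
    simp [h1, h2, shiftProd]
  · have h1 := h.cross ha hB hcard 0 B.card h0 le_rfl
    have h2 := pow_le_pow_left₀ hx hxy B.card
    nlinarith [mul_nonneg (sub_nonneg.2 h1) (sub_nonneg.2 h2)]

theorem SymmChain.shiftProd_cross_strict (h : SymmChain a B) (ha : ∀ t ∈ a, 0 < t)
    (hB : ∀ t ∈ B, 0 < t) (hcard : a.card ≤ B.card) (hne : a ≠ B) (h0 : B.card ≠ 0)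
    {x y : ℝ} (hx : 0 ≤ x) (hxy : x < y) :
    shiftProd a y / shiftProd B y < shiftProd a x / shiftProd B x := by
  have hc := sum_mul_sum_pow_cross
    (fun i => if i ≤ a.card then a.esymm (a.card - i) else 0)
    (fun i => if i ≤ B.card then B.esymm (B.card - i) else 0) B.card
    (h.cross ha hB hcard) hx hxy.le
  rw [← shiftProd_eq_sum a x hcard, ← shiftProd_eq_sum a y hcard, ← shiftProd_eq_sum B x le_rfl,
    ← shiftProd_eq_sum B y le_rfl] at hc
  rw [div_lt_div_iff₀ (shiftProd_pos hB (hx.trans hxy.le)) (shiftProd_pos hB hx)]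
  have h1 := h.cross_strict ha hcard hne
  have h2 := pow_lt_pow_left₀ hxy hx h0
  simp only [Nat.zero_le, if_true, Nat.sub_zero, le_refl, Nat.sub_self, multiset_esymm_zero,
    mul_one] at hc
  nlinarith [mul_pos (sub_pos.2 h1) (sub_pos.2 h2)]

end Chain

/-! ### The coefficients of the hypergeometric series -/

/-- The coefficient `(a₁)ₙ ⋯ (aₚ)ₙ / ((b₁)ₙ ⋯ (b_q)ₙ n!)` of `xⁿ` in the hypergeometric series. -/
noncomputable def hypCoeff (a b : Multiset ℝ) (n : ℕ) : ℝ :=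
  risingProd a n / (risingProd b n * (n ! : ℝ))

theorem risingProd_zero (a : Multiset ℝ) : risingProd a 0 = 1 := by
  simp [risingProd]

theorem risingProd_succ (a : Multiset ℝ) (n : ℕ) :
    risingProd a (n + 1) = risingProd a n * shiftProd a n := by
  rw [risingProd, risingProd, shiftProd, ← Multiset.prod_map_mul]
  simp only [ascPochhammer_succ_eval]

theorem hypCoeff_zero (a b : Multiset ℝ) : hypCoeff a b 0 = 1 := by
  simp [hypCoeff, risingProd_zero]

theorem hypCoeff_succ (a b : Multiset ℝ) (n : ℕ) :
    hypCoeff a b (n + 1) = hypCoeff a b n * (shiftProd a n / shiftProd (1 ::ₘ b) n) := by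
  have : shiftProd (1 ::ₘ b) n = (n + 1) * shiftProd b n := by
    simp [shiftProd, add_comm]
  rw [hypCoeff, hypCoeff, risingProd_succ, risingProd_succ, this, div_mul_div_comm,
    Nat.factorial_succ, Nat.cast_mul, Nat.cast_succ]
  congr 1
  ring

/-- The properties of the coefficients of the hypergeometric series on which the argument rests:
they are positive, start at `1` and are log-concave, that is, their consecutive ratios `R n`
decrease. -/
structure IsLogConcaveSeq (h R : ℕ → ℝ) : Prop where
  zero : h 0 = 1
  succ : ∀ n, h (n + 1) = h n * R n
  ratio_pos : ∀ n, 0 < R n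
  ratio_antitone : Antitone R

theorem isLogConcaveSeq_hypCoeff {a b : Multiset ℝ} (hpq : a.card ≤ b.card + 1)
    (ha : ∀ t ∈ a, 0 < t) (hb : ∀ t ∈ b, 0 < t) (hchain : SymmChain a (1 ::ₘ b)) :
    IsLogConcaveSeq (hypCoeff a b) fun n => shiftProd a n / shiftProd (1 ::ₘ b) n where
  zero := hypCoeff_zero a b
  succ := hypCoeff_succ a b
  ratio_pos n := div_pos (shiftProd_pos ha n.cast_nonneg)
    (shiftProd_pos (by simpa using hb) n.cast_nonneg)
  ratio_antitone m n hmn := hchain.shiftProd_cross ha (by simpa using hb)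
    (by simpa using hpq) m.cast_nonneg (by exact_mod_cast hmn)

theorem shiftProd_ratio_strictAnti {a b : Multiset ℝ} (hpq : a.card ≤ b.card + 1)
    (ha : ∀ t ∈ a, 0 < t) (hb : ∀ t ∈ b, 0 < t) (hchain : SymmChain a (1 ::ₘ b))
    (hne : a ≠ 1 ::ₘ b) :
    StrictAnti fun n : ℕ => shiftProd a n / shiftProd (1 ::ₘ b) n := fun m n hmn =>
  hchain.shiftProd_cross_strict ha (by simpa using hb) (by simpa using hpq) hne (by simp)
    m.cast_nonneg (by exact_mod_cast hmn)

namespace IsLogConcaveSeq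

variable {h R : ℕ → ℝ}

theorem pos (H : IsLogConcaveSeq h R) (n : ℕ) : 0 < h n := by
  induction n with
  | zero => rw [H.zero]; exact one_pos
  | succ n ih => rw [H.succ]; exact mul_pos ih (H.ratio_pos n)

theorem le_pow (H : IsLogConcaveSeq h R) (n : ℕ) : h n ≤ R 0 ^ n := by
  induction n with
  | zero => simp [H.zero]
  | succ n ih =>
    rw [H.succ, pow_succ]
    exact mul_le_mul ih (H.ratio_antitone (Nat.zero_le n)) (H.ratio_pos n).le
      (pow_nonneg (H.ratio_pos 0).le n)

theorem mul_le_mul_succ (H : IsLogConcaveSeq h R) {m k : ℕ} (hk : 2 * (k + 1) ≤ m) :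
    h k * h (m - k) ≤ h (k + 1) * h (m - (k + 1)) := by
  obtain ⟨l, hl⟩ : ∃ l, m - k = l + 1 := ⟨m - k - 1, by omega⟩
  rw [show m - (k + 1) = l by omega, hl, H.succ, H.succ]
  have := H.ratio_antitone (show k ≤ l by omega)
  nlinarith [mul_le_mul_of_nonneg_left this (mul_pos (H.pos k) (H.pos l)).le]

theorem mul_le_mul_of_le (H : IsLogConcaveSeq h R) {m k l : ℕ} (hkl : k ≤ l) (hl : 2 * l ≤ m) :
    h k * h (m - k) ≤ h l * h (m - l) := by
  induction l, hkl using Nat.le_induction with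
  | base => exact le_rfl
  | succ l _ ih => exact (ih (by omega)).trans (H.mul_le_mul_succ hl)

theorem zero_mul_lt (H : IsLogConcaveSeq h R) (hR : StrictAnti R) {m : ℕ} (hm : 2 ≤ m) :
    h 0 * h m < h 1 * h (m - 1) := by
  obtain ⟨l, rfl⟩ : ∃ l, m = l + 1 := ⟨m - 1, by omega⟩
  rw [Nat.add_sub_cancel, H.succ l, show h 1 = h 0 * R 0 from H.succ 0]
  have := hR (show 0 < l by omega)
  nlinarith [mul_lt_mul_of_pos_left this (mul_pos (H.pos 0) (H.pos l))]

end IsLogConcaveSeq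

/-! ### The reciprocal Gamma function -/

/-- The entire function `1 / Γ` on the real line; it vanishes at `0, -1, -2, …`. -/
noncomputable def rGamma (z : ℝ) : ℝ := (Real.Gamma z)⁻¹

theorem rGamma_eq_mul_add_one (z : ℝ) : rGamma z = z * rGamma (z + 1) := by
  rcases eq_or_ne z 0 with rfl | hz
  · simp [rGamma]
  · rw [rGamma, rGamma, Real.Gamma_add_one hz, mul_inv, mul_inv_cancel_left₀ hz]

theorem rGamma_zero : rGamma 0 = 0 := by simp [rGamma]

theorem rGamma_pos {z : ℝ} (hz : 0 < z) : 0 < rGamma z := inv_pos.2 (Real.Gamma_pos_of_pos hz)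

theorem rGamma_nonneg {z : ℝ} (hz : 0 ≤ z) : 0 ≤ rGamma z :=
  inv_nonneg.2 (Real.Gamma_nonneg_of_nonneg hz)

theorem continuous_rGamma : Continuous rGamma := by
  have h : rGamma = fun z : ℝ => ((Complex.Gamma (z : ℂ))⁻¹).re := by
    funext z
    rw [Complex.Gamma_ofReal, ← Complex.ofReal_inv, Complex.ofReal_re, rGamma]
  rw [h]
  exact Complex.continuous_re.comp
    (Complex.differentiable_one_div_Gamma.continuous.comp Complex.continuous_ofReal)

theorem rGamma_mul_le {x y : ℝ} (hx : 0 < x) (hxy : x ≤ y) (n : ℕ) :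
    rGamma x * rGamma (y + n) ≤ rGamma (x + n) * rGamma y := by
  induction n with
  | zero => simp
  | succ n ih =>
    have hn : (0 : ℝ) ≤ n := n.cast_nonneg
    have hA := rGamma_pos (show 0 < x + n + 1 by linarith)
    have hB := rGamma_pos (show 0 < y + n + 1 by linarith)
    have hx' := rGamma_pos hx
    have hy' := rGamma_pos (hx.trans_le hxy)
    rw [rGamma_eq_mul_add_one (x + n), rGamma_eq_mul_add_one (y + n)] at ih
    rw [Nat.cast_succ, ← add_assoc, ← add_assoc]
    have hxn : 0 < x + n := by linarith
    refine le_of_mul_le_mul_left ?_ hxn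
    calc (x + n) * (rGamma x * rGamma (y + n + 1))
        ≤ (y + n) * (rGamma x * rGamma (y + n + 1)) :=
          mul_le_mul_of_nonneg_right (by linarith) (mul_pos hx' hB).le
      _ = rGamma x * ((y + n) * rGamma (y + n + 1)) := by ring
      _ ≤ (x + n) * rGamma (x + n + 1) * rGamma y := ih
      _ = _ := by ring

theorem rGamma_mul_lt {x y : ℝ} (hx : 0 < x) (hxy : x < y) (n : ℕ) :
    rGamma x * rGamma (y + (n + 1)) < rGamma (x + (n + 1)) * rGamma y := by
  have h := rGamma_mul_le (show 0 < x + 1 by linarith) (show x + 1 ≤ y + 1 by linarith) n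
  have hn : (0 : ℝ) ≤ n := n.cast_nonneg
  rw [show y + (n + 1) = y + 1 + n by ring, show x + ((n : ℝ) + 1) = x + 1 + n by ring,
    rGamma_eq_mul_add_one x, rGamma_eq_mul_add_one y]
  have hA := mul_pos (rGamma_pos (show 0 < x + 1 by linarith))
    (rGamma_pos (show 0 < y + 1 + n by linarith))
  nlinarith

/-! ### The coefficients of the Turanian -/

/-- The contribution of the pair of indices `(k, l)` to the coefficient of `x ^ (k + l)` in the
Turanian, apart from the factor `h k * h l`. -/
noncomputable def turanTerm (β μ : ℝ) (k l : ℕ) : ℝ :=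
  (l - k + β) * rGamma (k + μ + 1) * rGamma (l + μ + β + 1)

theorem turanTerm_eq (β μ : ℝ) (k l : ℕ) :
    turanTerm β μ k l = rGamma (μ + 1 + k) * rGamma (μ + β + l) -
      rGamma (μ + k) * rGamma (μ + β + 1 + l) := by
  rw [turanTerm, rGamma_eq_mul_add_one (μ + β + l), rGamma_eq_mul_add_one (μ + k),
    show μ + β + l + 1 = l + μ + β + 1 by ring, show μ + β + 1 + l = l + μ + β + 1 by ring,
    show μ + k + 1 = k + μ + 1 by ring, show μ + 1 + k = k + μ + 1 by ring]
  ring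

/-- The sum of the terms along a diagonal telescopes. -/
theorem sum_turanTerm (β μ : ℝ) (m : ℕ) :
    ∑ k ∈ Finset.range (m + 1), turanTerm β μ k (m - k) =
      rGamma (μ + (m + 1)) * rGamma (μ + β) - rGamma μ * rGamma (μ + β + (m + 1)) := by
  have h := Finset.sum_range_sub
    (fun k : ℕ => rGamma (μ + k) * rGamma (μ + β + ((m : ℝ) + 1 - k))) (m + 1)
  have h2 : μ + β + ((m : ℝ) + 1 - ((m + 1 : ℕ) : ℝ)) = μ + β := by push_cast; ring
  rw [h2] at h
  simp only [Nat.cast_zero, add_zero, sub_zero] at h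
  push_cast at h
  rw [← h]
  refine Finset.sum_congr rfl fun k hk => ?_
  rw [turanTerm_eq, Nat.cast_sub (Nat.lt_succ_iff.1 (Finset.mem_range.1 hk))]
  ring_nf

theorem sum_turanTerm_pos {β μ : ℝ} (hμ : -1 < μ) (hβ : 0 < β) (hμβ : 0 ≤ μ + β) (m : ℕ) :
    0 < ∑ k ∈ Finset.range (m + 1), turanTerm β μ k (m - k) := by
  rw [sum_turanTerm, sub_pos]
  have hm : (0 : ℝ) ≤ m := m.cast_nonneg
  rcases lt_or_ge 0 μ with h0 | h0
  · exact rGamma_mul_lt h0 (by linarith) m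
  · have h1 := rGamma_pos (show 0 < μ + (m + 1) by linarith)
    have h2 := rGamma_pos (show 0 < μ + β + (m + 1) by linarith)
    have h3 := rGamma_nonneg hμβ
    have h4 := rGamma_pos (show 0 < μ + 1 by linarith)
    rw [rGamma_eq_mul_add_one μ]
    rcases h0.lt_or_eq with h0 | rfl
    · nlinarith [mul_nonneg h1.le h3, mul_pos (mul_pos (neg_pos.2 h0) h4) h2]
    · have := mul_pos h1 (rGamma_pos (show 0 < 0 + β by linarith))
      simpa using this

theorem sum_turanTerm_neg_one (β : ℝ) (m : ℕ) :
    ∑ k ∈ Finset.range (m + 1), turanTerm β (-1) k (m - k) = rGamma m * rGamma (β - 1) := by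
  rw [sum_turanTerm, rGamma_eq_mul_add_one (-1), neg_add_cancel, rGamma_zero, mul_zero, zero_mul,
    sub_zero, show -1 + ((m : ℝ) + 1) = m by ring, show -1 + β = β - 1 by ring]

/-- The sign change property: along a diagonal, from the border to the middle, the symmetrized
terms stay nonnegative once they are nonnegative. Moving one step to the middle multiplies the
first of the two competing products of reciprocal Gamma values by a larger factor than the
second. -/
theorem turanTerm_symm_step {β μ : ℝ} (hμ : -1 ≤ μ) (hβ : 0 < β) {k l : ℕ} (hkl : k + 1 ≤ l)
    (h : 0 ≤ turanTerm β μ k (l + 1) + turanTerm β μ (l + 1) k) :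
    0 ≤ turanTerm β μ (k + 1) l + turanTerm β μ l (k + 1) := by
  have hk : (0 : ℝ) ≤ k := k.cast_nonneg
  have hkl' : (k : ℝ) + 1 ≤ l := by exact_mod_cast hkl
  obtain ⟨p, hp⟩ : ∃ p : ℝ, p = k + μ + 1 := ⟨_, rfl⟩
  obtain ⟨s, hs⟩ : ∃ s : ℝ, s = l + μ + 1 := ⟨_, rfl⟩
  have hp0 : 0 ≤ p := by linarith
  have hsp : p + 1 ≤ s := by linarith
  have eA := rGamma_eq_mul_add_one p
  have eB := rGamma_eq_mul_add_one (p + β)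
  have eC := rGamma_eq_mul_add_one s
  have eD := rGamma_eq_mul_add_one (s + β)
  have hA := rGamma_pos (show 0 < p + 1 by linarith)
  have hB := rGamma_pos (show 0 < p + β + 1 by linarith)
  have hC := rGamma_pos (show 0 < s + 1 by linarith)
  have hD := rGamma_pos (show 0 < s + β + 1 by linarith)
  simp only [turanTerm] at h ⊢
  push_cast at h ⊢
  rw [show (k : ℝ) + μ + 1 = p from hp.symm, show (l : ℝ) + 1 + μ + β + 1 = s + β + 1 by linarith,
    show (l : ℝ) + 1 + μ + 1 = s + 1 by linarith, show (k : ℝ) + μ + β + 1 = p + β by linarith,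
    eA, eB, show (l : ℝ) + 1 - k + β = s - p + 1 + β by linarith,
    show (k : ℝ) - (l + 1) + β = p - s - 1 + β by linarith] at h
  rw [show (k : ℝ) + 1 + μ + 1 = p + 1 by linarith, show (l : ℝ) + μ + β + 1 = s + β by linarith,
    show (l : ℝ) + μ + 1 = s from hs.symm, show (k : ℝ) + 1 + μ + β + 1 = p + β + 1 by linarith,
    eC, eD, show (l : ℝ) - (k + 1) + β = s - p - 1 + β by linarith,
    show (k : ℝ) + 1 - l + β = p - s + 1 + β by linarith]
  clear eA eB eC eD
  generalize rGamma (p + 1) = A at *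
  generalize rGamma (p + β + 1) = B at *
  generalize rGamma (s + 1) = C at *
  generalize rGamma (s + β + 1) = D at *
  have hAD := mul_pos hA hD
  have hBC := mul_pos hB hC
  generalize hX : A * D = X at *
  generalize hY : B * C = Y at *
  have h' : (s - p + 1 - β) * (p + β) * Y ≤ (s - p + 1 + β) * p * X := by
    rw [← hX, ← hY]; linarith
  suffices hgoal : (s - p - 1 - β) * s * Y ≤ (s - p - 1 + β) * (s + β) * X by
    rw [← hX, ← hY] at hgoal; linarith
  rcases le_or_gt (s - p - 1) β with ht | ht
  · have h1 : (s - p - 1 - β) * s * Y ≤ 0 :=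
      mul_nonpos_of_nonpos_of_nonneg (mul_nonpos_of_nonpos_of_nonneg (by linarith) (by linarith))
        hBC.le
    have h2 : 0 ≤ (s - p - 1 + β) * (s + β) * X :=
      mul_nonneg (mul_nonneg (by linarith) (by linarith)) hAD.le
    exact h1.trans h2
  · have hpos : 0 < (s - p + 1 - β) * (p + β) * Y :=
      mul_pos (mul_pos (by linarith) (by linarith)) hBC
    have hp1 : 0 < p := by
      rcases hp0.lt_or_eq with h0 | h0
      · exact h0
      · rw [← h0] at h' hpos; simp at h'; linarith
    have hq : 0 < (s - p + 1 + β) * p := mul_pos (by linarith) hp1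
    refine le_of_mul_le_mul_left ?_ hq
    have e1 : (s - p - 1 - β) * (s - p + 1 + β) ≤ (s - p - 1 + β) * (s - p + 1 - β) := by
      nlinarith
    have e2 : s * p ≤ (s + β) * (p + β) := by nlinarith
    calc (s - p + 1 + β) * p * ((s - p - 1 - β) * s * Y)
        = (s - p - 1 - β) * (s - p + 1 + β) * (s * p) * Y := by ring
      _ ≤ (s - p - 1 + β) * (s - p + 1 - β) * ((s + β) * (p + β)) * Y :=
        mul_le_mul_of_nonneg_right (mul_le_mul e1 e2 (mul_nonneg (by linarith) hp0)
          (mul_nonneg (by linarith) (by linarith))) hBC.le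
      _ = (s - p - 1 + β) * (s + β) * ((s - p + 1 - β) * (p + β) * Y) := by ring
      _ ≤ (s - p - 1 + β) * (s + β) * ((s - p + 1 + β) * p * X) :=
        mul_le_mul_of_nonneg_left h' (mul_nonneg (by linarith) (by linarith))
      _ = _ := by ring

theorem turanTerm_symm_nonneg_of_le {β μ : ℝ} (hμ : -1 ≤ μ) (hβ : 0 < β) {m k l : ℕ} (hkl : k ≤ l)
    (hl : 2 * l ≤ m) (h : 0 ≤ turanTerm β μ k (m - k) + turanTerm β μ (m - k) k) :
    0 ≤ turanTerm β μ l (m - l) + turanTerm β μ (m - l) l := by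
  induction l, hkl using Nat.le_induction with
  | base => exact h
  | succ l _ ih =>
    have := ih (by omega)
    rw [show m - l = m - (l + 1) + 1 by omega] at this
    exact turanTerm_symm_step hμ hβ (by omega) this

/-- A Chebyshev-type argument: if `S` changes sign at most once, from minus to plus, on the first
half of `{0, …, m}`, if `w` increases there and both are symmetric, then replacing `w` by its
value `w j` at the sign change decreases every term of `∑ w k * S k`. -/
theorem exists_sub_mul_nonneg {m : ℕ} {w S : ℕ → ℝ} (hwsymm : ∀ k ≤ m, w (m - k) = w k)
    (hSsymm : ∀ k ≤ m, S (m - k) = S k) (hw : ∀ k l, k ≤ l → 2 * l ≤ m → w k ≤ w l)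
    (hS : ∀ k l, k ≤ l → 2 * l ≤ m → 0 ≤ S k → 0 ≤ S l)
    (hsum : 0 ≤ ∑ k ∈ Finset.range (m + 1), S k) :
    ∃ j, 2 * j ≤ m ∧ 0 ≤ S j ∧ ∀ k ≤ m, 0 ≤ (w k - w j) * S k := by
  classical
  have hhalf : ∀ P : ℕ → Prop, (∀ k ≤ m, P (m - k) → P k) → (∀ k, 2 * k ≤ m → P k) →
      ∀ k ≤ m, P k := by
    intro P hP h k hk
    rcases Nat.lt_or_ge m (2 * k) with h2 | h2
    · exact hP k hk (h _ (by omega))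
    · exact h k h2
  have hex : ∃ j, 2 * j ≤ m ∧ 0 ≤ S j := by
    by_contra! hneg
    have hall : ∀ k ≤ m, S k < 0 :=
      hhalf (fun k => S k < 0) (fun k hk h => by rwa [hSsymm k hk] at h) hneg
    exact absurd hsum (not_le.2 (Finset.sum_neg
      (fun k hk => hall k (Nat.lt_succ_iff.1 (Finset.mem_range.1 hk))) ⟨0, by simp⟩))
  refine ⟨Nat.find hex, (Nat.find_spec hex).1, (Nat.find_spec hex).2, ?_⟩
  refine hhalf (fun k => 0 ≤ (w k - w (Nat.find hex)) * S k)
    (fun k hk h => by rwa [hSsymm k hk, hwsymm k hk] at h) fun k hk => ?_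
  rcases Nat.lt_or_ge k (Nat.find hex) with hlt | hge
  · have h1 : S k < 0 := by
      by_contra! h
      exact Nat.find_min hex hlt ⟨hk, h⟩
    exact mul_nonneg_of_nonpos_of_nonpos
      (sub_nonpos.2 (hw _ _ hlt.le (Nat.find_spec hex).1)) h1.le
  · exact mul_nonneg (sub_nonneg.2 (hw _ _ hge hk)) (hS _ _ hge hk (Nat.find_spec hex).2)

theorem two_mul_sum_range_symm (w : ℕ → ℝ) (T : ℕ → ℕ → ℝ) (m : ℕ)
    (hw : ∀ k ≤ m, w (m - k) = w k) :
    2 * ∑ k ∈ Finset.range (m + 1), w k * T k (m - k) =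
      ∑ k ∈ Finset.range (m + 1), w k * (T k (m - k) + T (m - k) k) := by
  have h : ∑ k ∈ Finset.range (m + 1), w k * T k (m - k) =
      ∑ k ∈ Finset.range (m + 1), w k * T (m - k) k := by
    rw [← Finset.sum_range_reflect]
    refine Finset.sum_congr rfl fun k hk => ?_
    have hk' : k ≤ m := Nat.lt_succ_iff.1 (Finset.mem_range.1 hk)
    rw [show m + 1 - 1 - k = m - k by omega, hw k hk', Nat.sub_sub_self hk']
  rw [two_mul]
  nth_rewrite 2 [h]
  rw [← Finset.sum_add_distrib]
  simp only [mul_add]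

/-- The coefficient of `x ^ m` in the Turanian of `∑ h n * x ^ n / Γ (ν + n)`. -/
noncomputable def turanCoeff (h : ℕ → ℝ) (β μ : ℝ) (m : ℕ) : ℝ :=
  ∑ k ∈ Finset.range (m + 1), h k * h (m - k) * turanTerm β μ k (m - k)

namespace IsLogConcaveSeq

variable {h R : ℕ → ℝ} {β μ : ℝ}

/-- The Chebyshev-type bound for the coefficients of the Turanian, with `j` the place of the sign
change. One nonnegative term of the difference is retained, for strict inequalities. -/
theorem exists_turanCoeff_ge (H : IsLogConcaveSeq h R) (hμ : -1 ≤ μ) (hβ : 0 < β) {m : ℕ}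
    (hsum : 0 ≤ ∑ k ∈ Finset.range (m + 1), turanTerm β μ k (m - k)) :
    ∃ j, 2 * j ≤ m ∧ 0 ≤ turanTerm β μ j (m - j) + turanTerm β μ (m - j) j ∧
      ∀ i ≤ m, (h i * h (m - i) - h j * h (m - j)) *
          (turanTerm β μ i (m - i) + turanTerm β μ (m - i) i) +
        2 * (h j * h (m - j) * ∑ k ∈ Finset.range (m + 1), turanTerm β μ k (m - k)) ≤
        2 * turanCoeff h β μ m := by
  have hwsymm : ∀ k ≤ m, h (m - k) * h (m - (m - k)) = h k * h (m - k) := fun k hk => by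
    rw [Nat.sub_sub_self hk, mul_comm]
  have hsum2 := two_mul_sum_range_symm (fun _ => 1) (turanTerm β μ) m fun _ _ => rfl
  simp only [one_mul] at hsum2
  obtain ⟨j, hj, hSj, hall⟩ := exists_sub_mul_nonneg (m := m) (w := fun k => h k * h (m - k))
    (S := fun k => turanTerm β μ k (m - k) + turanTerm β μ (m - k) k) hwsymm
    (fun k hk => by simp only [Nat.sub_sub_self hk]; ring)
    (fun k l hkl hl => H.mul_le_mul_of_le hkl hl)
    (fun k l hkl hl hk => turanTerm_symm_nonneg_of_le hμ hβ hkl hl hk) (by linarith)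
  refine ⟨j, hj, hSj, fun i hi => ?_⟩
  have h2 := two_mul_sum_range_symm (fun k => h k * h (m - k)) (turanTerm β μ) m hwsymm
  have h3 := Finset.single_le_sum (s := Finset.range (m + 1))
    (f := fun k => (h k * h (m - k) - h j * h (m - j)) *
      (turanTerm β μ k (m - k) + turanTerm β μ (m - k) k))
    (fun k hk => hall k (Nat.lt_succ_iff.1 (Finset.mem_range.1 hk)))
    (Finset.mem_range.2 (Nat.lt_succ_iff.2 hi))
  simp only [sub_mul, Finset.sum_sub_distrib, ← Finset.mul_sum] at h3 h2
  rw [turanCoeff, h2]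
  rw [← hsum2] at h3
  linarith

theorem le_turanCoeff (H : IsLogConcaveSeq h R) (hμ : -1 ≤ μ) (hβ : 0 < β) {m : ℕ}
    (hsum : 0 ≤ ∑ k ∈ Finset.range (m + 1), turanTerm β μ k (m - k)) :
    ∃ C, 0 < C ∧ C * ∑ k ∈ Finset.range (m + 1), turanTerm β μ k (m - k) ≤ turanCoeff h β μ m := by
  obtain ⟨j, hj, -, hall⟩ := H.exists_turanCoeff_ge hμ hβ hsum
  refine ⟨h j * h (m - j), mul_pos (H.pos _) (H.pos _), ?_⟩
  have := hall j (by omega)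
  rw [sub_self, zero_mul] at this
  linarith

theorem turanCoeff_pos (H : IsLogConcaveSeq h R) (hμ : -1 < μ) (hβ : 0 < β) (hμβ : 0 ≤ μ + β)
    (m : ℕ) : 0 < turanCoeff h β μ m := by
  have hs := sum_turanTerm_pos hμ hβ hμβ m
  obtain ⟨C, hC, hle⟩ := H.le_turanCoeff hμ.le hβ hs.le
  exact (mul_pos hC hs).trans_le hle

theorem turanCoeff_neg_one_nonneg (H : IsLogConcaveSeq h R) (hβ : 1 ≤ β) (m : ℕ) :
    0 ≤ turanCoeff h β (-1) m := by
  have hs := sum_turanTerm_neg_one β m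
  have h0 : 0 ≤ rGamma m * rGamma (β - 1) :=
    mul_nonneg (rGamma_nonneg m.cast_nonneg) (rGamma_nonneg (by linarith))
  obtain ⟨C, hC, hle⟩ := H.le_turanCoeff le_rfl (by linarith : 0 < β) (hs ▸ h0)
  exact (mul_nonneg hC.le (hs ▸ h0)).trans hle

theorem turanCoeff_neg_one_pos (H : IsLogConcaveSeq h R) (hβ : 1 < β) {m : ℕ} (hm : 1 ≤ m) :
    0 < turanCoeff h β (-1) m := by
  have hs := sum_turanTerm_neg_one β m
  have h0 : 0 < rGamma m * rGamma (β - 1) :=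
    mul_pos (rGamma_pos (by exact_mod_cast hm)) (rGamma_pos (by linarith))
  obtain ⟨C, hC, hle⟩ := H.le_turanCoeff le_rfl (by linarith : 0 < β) (hs ▸ h0.le)
  exact (mul_pos hC (hs ▸ h0)).trans_le hle

/-- For `μ = -1` and `β = 1` the unweighted sum vanishes; positivity comes from the border term
`k = 0`, which is negative and has a strictly smaller weight than the term at the sign change. -/
theorem turanCoeff_neg_one_one_pos (H : IsLogConcaveSeq h R) (hR : StrictAnti R) {m : ℕ}
    (hm : 2 ≤ m) : 0 < turanCoeff h 1 (-1) m := by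
  have hs : ∑ k ∈ Finset.range (m + 1), turanTerm 1 (-1) k (m - k) = 0 := by
    rw [sum_turanTerm_neg_one]; simp [rGamma_zero]
  have hm' : (2 : ℝ) ≤ m := by exact_mod_cast hm
  have hS0 : turanTerm 1 (-1) 0 (m - 0) + turanTerm 1 (-1) (m - 0) 0 < 0 := by
    have h1 := rGamma_pos (show (0 : ℝ) < m by linarith)
    have h2 := rGamma_pos one_pos
    have h3 := mul_pos h1 h2
    simp only [turanTerm, Nat.sub_zero, Nat.cast_zero, zero_add, neg_add_cancel, rGamma_zero,
      mul_zero, zero_mul, neg_add_cancel_right]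
    nlinarith
  obtain ⟨j, hj, hSj, hall⟩ := H.exists_turanCoeff_ge (β := 1) le_rfl one_pos (m := m) hs.ge
  have hj1 : 1 ≤ j := by
    by_contra! h0
    obtain rfl : j = 0 := by omega
    exact absurd hSj (not_le.2 hS0)
  have hw := (H.zero_mul_lt hR hm).trans_le (H.mul_le_mul_of_le hj1 hj)
  have h0 := hall 0 (Nat.zero_le m)
  rw [hs, mul_zero, mul_zero, add_zero] at h0
  have := mul_pos_of_neg_of_neg (sub_neg.2 hw) hS0
  rw [Nat.sub_zero] at this h0
  linarith

theorem turanCoeff_nonneg (H : IsLogConcaveSeq h R) (hμ : -1 ≤ μ) (hβ : 0 < β) (hμβ : 0 ≤ μ + β)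
    (m : ℕ) : 0 ≤ turanCoeff h β μ m := by
  rcases hμ.lt_or_eq with h1 | rfl
  · exact (H.turanCoeff_pos h1 hβ hμβ m).le
  · exact H.turanCoeff_neg_one_nonneg (by linarith) m

end IsLogConcaveSeq

/-! ### The coefficients governing the lower bound of the quotient -/

/-- The contribution of the pair of indices `(k, l)` to the coefficient of `x ^ (k + l)` in
`(μ + β) * g μ * g (μ + β + 1) - μ * g (μ + 1) * g (μ + β)`, apart from the factor `h k * h l`. -/
noncomputable def ratioTerm (β μ : ℝ) (k l : ℕ) : ℝ :=
  ((μ + β) * k - μ * l) * rGamma (k + μ + 1) * rGamma (l + μ + β + 1)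

theorem ratioTerm_eq (β μ : ℝ) (k l : ℕ) :
    ratioTerm β μ k l = (μ + β) * (rGamma (μ + k) * rGamma (μ + β + 1 + l)) -
      μ * (rGamma (μ + 1 + k) * rGamma (μ + β + l)) := by
  rw [ratioTerm, rGamma_eq_mul_add_one (μ + β + l), rGamma_eq_mul_add_one (μ + k),
    show μ + β + l + 1 = l + μ + β + 1 by ring, show μ + β + 1 + l = l + μ + β + 1 by ring,
    show μ + k + 1 = k + μ + 1 by ring, show μ + 1 + k = k + μ + 1 by ring]
  ring

theorem ratioTerm_symm_nonneg {β μ : ℝ} (hμ : -1 ≤ μ) (hβ : 0 < β) (hμβ : 0 < μ + β) (k l : ℕ) :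
    0 ≤ ratioTerm β μ k l + ratioTerm β μ l k := by
  wlog hkl : k ≤ l generalizing k l
  · rw [add_comm]; exact this l k (by omega)
  have hk : (0 : ℝ) ≤ k := k.cast_nonneg
  have hkl' : (k : ℝ) ≤ l := by exact_mod_cast hkl
  rcases le_or_gt μ 0 with h0 | h0
  · have hnn : ∀ i j : ℕ, 0 ≤ ratioTerm β μ i j := fun i j => by
      have hi : (0 : ℝ) ≤ i := i.cast_nonneg
      have hj : (0 : ℝ) ≤ j := j.cast_nonneg
      refine mul_nonneg (mul_nonneg ?_ (rGamma_nonneg (by linarith))) (rGamma_nonneg (by linarith))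
      nlinarith [mul_nonneg hμβ.le hi, mul_nonneg (neg_nonneg.2 h0) hj]
    exact add_nonneg (hnn _ _) (hnn _ _)
  · obtain ⟨n, rfl⟩ := Nat.exists_eq_add_of_le hkl
    have hle := rGamma_mul_le (show 0 < (k : ℝ) + μ + 1 by linarith)
      (show (k : ℝ) + μ + 1 ≤ k + μ + β + 1 by linarith) n
    rw [ratioTerm, ratioTerm]
    push_cast at hkl' ⊢
    rw [show (k : ℝ) + n + μ + β + 1 = k + μ + β + 1 + n by ring,
      show (k : ℝ) + n + μ + 1 = k + μ + 1 + n by ring]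
    have hn : (0 : ℝ) ≤ n := n.cast_nonneg
    have hD := mul_pos (rGamma_pos (show 0 < (k : ℝ) + μ + 1 by linarith))
      (rGamma_pos (show 0 < (k : ℝ) + μ + β + 1 + n by linarith))
    rw [mul_assoc, mul_assoc]
    generalize rGamma (k + μ + 1) * rGamma (k + μ + β + 1 + n) = D at *
    generalize rGamma (k + μ + 1 + n) * rGamma (k + μ + β + 1) = E at *
    -- The factor of the larger product `E` is nonnegative, and so is the sum of the two factors.
    have hV : 0 ≤ (μ + β) * (k + n) - μ * k := by nlinarith
    have hVV : 0 ≤ (μ + β) * k - μ * (k + n) + ((μ + β) * (k + n) - μ * k) := by nlinarith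
    nlinarith [mul_nonneg hV (sub_nonneg.2 hle), mul_nonneg hVV hD.le]

/-- The coefficient of `x ^ m` in
`(μ + β) * g μ * g (μ + β + 1) - μ * g (μ + 1) * g (μ + β)`. -/
noncomputable def ratioCoeff (h : ℕ → ℝ) (β μ : ℝ) (m : ℕ) : ℝ :=
  ∑ k ∈ Finset.range (m + 1), h k * h (m - k) * ratioTerm β μ k (m - k)

namespace IsLogConcaveSeq

variable {h R : ℕ → ℝ} {β μ : ℝ}

theorem ratioCoeff_nonneg (H : IsLogConcaveSeq h R) (hμ : -1 ≤ μ) (hβ : 0 < β) (hμβ : 0 < μ + β)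
    (m : ℕ) : 0 ≤ ratioCoeff h β μ m := by
  have h2 := two_mul_sum_range_symm (fun k => h k * h (m - k)) (ratioTerm β μ) m
    fun k hk => by rw [Nat.sub_sub_self hk, mul_comm]
  have h3 : 0 ≤ 2 * ratioCoeff h β μ m := by
    rw [ratioCoeff, h2]
    exact Finset.sum_nonneg fun k _ => mul_nonneg (mul_pos (H.pos _) (H.pos _)).le
      (ratioTerm_symm_nonneg hμ hβ hμβ _ _)
  linarith

theorem ratioCoeff_one_pos (H : IsLogConcaveSeq h R) (hμ : -1 ≤ μ) (hβ : 0 < β)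
    (hμβ : 0 < μ + β) : 0 < ratioCoeff h β μ 1 := by
  have e : ratioCoeff h β μ 1 = h 0 * h 1 * (β * (2 * μ + β + 1)) *
      (rGamma (μ + 1 + 1) * rGamma (μ + β + 1 + 1)) := by
    simp only [ratioCoeff, ratioTerm, Finset.sum_range_succ, Finset.sum_range_zero]
    norm_num
    rw [rGamma_eq_mul_add_one (μ + 1), rGamma_eq_mul_add_one (μ + β + 1),
      show 1 + μ + 1 = μ + 1 + 1 by ring, show 1 + μ + β + 1 = μ + β + 1 + 1 by ring]
    ring
  rw [e]
  have h1 := rGamma_pos (show 0 < μ + 1 + 1 by linarith)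
  have h2 := rGamma_pos (show 0 < μ + β + 1 + 1 by linarith)
  have h3 : 0 < 2 * μ + β + 1 := by linarith
  have := H.pos 0
  have := H.pos 1
  positivity

end IsLogConcaveSeq

/-! ### Convergence, continuity and products of the normalized series -/

theorem rGamma_eq_ascPochhammer_mul (z : ℝ) (n : ℕ) :
    rGamma z = (ascPochhammer ℝ n).eval z * rGamma (z + n) := by
  induction n with
  | zero => simp
  | succ n ih =>
    rw [ih, rGamma_eq_mul_add_one (z + n), ascPochhammer_succ_eval, Nat.cast_succ]
    ring_nf

theorem normHypTerm_eq (a b : Multiset ℝ) (ν x : ℝ) (n : ℕ) :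
    normHypTerm a b ν x n = hypCoeff a b n * x ^ n * rGamma (ν + n) := rfl

theorem normHypTerm_zero (a b : Multiset ℝ) (ν x : ℝ) : normHypTerm a b ν x 0 = rGamma ν := by
  simp [normHypTerm_eq, hypCoeff_zero]

theorem normHyp_zero_right (a b : Multiset ℝ) (ν : ℝ) : normHyp a b ν 0 = rGamma ν := by
  rw [normHyp, tsum_eq_single 0, normHypTerm_zero]
  intro n hn
  simp [normHypTerm_eq, hn]

theorem hypTerm_cons_eq (a b : Multiset ℝ) {ν : ℝ} (hν : ∀ k : ℕ, ν ≠ -(k : ℝ)) (x : ℝ) (n : ℕ) :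
    hypTerm a (ν ::ₘ b) x n = Real.Gamma ν * normHypTerm a b ν x n := by
  have hΓ : Real.Gamma ν ≠ 0 := Real.Gamma_ne_zero hν
  have hr := rGamma_eq_ascPochhammer_mul ν n
  have hP : (ascPochhammer ℝ n).eval ν ≠ 0 := by
    intro h0
    rw [h0, zero_mul] at hr
    exact inv_ne_zero hΓ hr
  have hr' : rGamma (ν + n) = (Real.Gamma ν)⁻¹ / (ascPochhammer ℝ n).eval ν := by
    rw [eq_div_iff hP, mul_comm]; exact hr.symm
  have hcons : risingProd (ν ::ₘ b) n = (ascPochhammer ℝ n).eval ν * risingProd b n := by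
    simp [risingProd]
  rw [normHypTerm_eq, hr', hypTerm, hypCoeff, hcons, mul_assoc (Polynomial.eval ν _),
    ← div_div, div_right_comm]
  field_simp

theorem hypTuranian_zero (a b : Multiset ℝ) (β μ : ℝ) :
    hypTuranian a b β μ 0 = β * rGamma (μ + 1) * rGamma (μ + β + 1) := by
  simp only [hypTuranian, normHyp_zero_right]
  rw [rGamma_eq_mul_add_one μ, rGamma_eq_mul_add_one (μ + β)]
  ring

namespace IsLogConcaveSeq

variable {a b : Multiset ℝ} {R : ℕ → ℝ}

/-- A summable bound for the terms of the normalized series, uniform for `ν` in a bounded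
interval. For `n ≥ N + 2` it comes from `Γ (ν + n) ≥ Γ (n - N) ≥ (n - N - 2)!`. -/
theorem exists_summable_bound (H : IsLogConcaveSeq (hypCoeff a b) R) (N : ℕ) (x : ℝ) :
    ∃ u : ℕ → ℝ, Summable u ∧ ∀ n, ∀ ν ∈ Icc (-(N : ℝ)) N, ‖normHypTerm a b ν x n‖ ≤ u n := by
  have hB : ∀ n : ℕ, ∃ C, ∀ ν ∈ Icc (-(N : ℝ)) N, ‖rGamma (ν + n)‖ ≤ C := fun n =>
    isCompact_Icc.exists_bound_of_continuousOn
      (continuous_rGamma.comp (continuous_id.add continuous_const)).continuousOn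
  choose C hC using hB
  have hterm : ∀ (n : ℕ) (ν : ℝ), ‖normHypTerm a b ν x n‖ ≤
      (R 0 * |x|) ^ n * ‖rGamma (ν + n)‖ := by
    intro n ν
    rw [normHypTerm_eq, norm_mul, norm_mul, norm_pow, Real.norm_of_nonneg (H.pos n).le, mul_pow]
    exact mul_le_mul_of_nonneg_right
      (mul_le_mul_of_nonneg_right (H.le_pow n) (by positivity)) (norm_nonneg _)
  have hRx : 0 ≤ R 0 * |x| := mul_nonneg (H.ratio_pos 0).le (abs_nonneg x)
  refine ⟨fun n => (R 0 * |x|) ^ n * if n < N + 2 then C n else ((n - (N + 2)) ! : ℝ)⁻¹, ?_, ?_⟩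
  · rw [← summable_nat_add_iff (N + 2)]
    refine ((Real.summable_pow_div_factorial (R 0 * |x|)).mul_left
      ((R 0 * |x|) ^ (N + 2))).congr fun n => ?_
    rw [if_neg (by omega), Nat.add_sub_cancel, pow_add]
    ring
  · intro n ν hν
    refine (hterm n ν).trans (mul_le_mul_of_nonneg_left ?_ (pow_nonneg hRx n))
    split_ifs with hn
    · exact hC n ν hν
    · obtain ⟨j, rfl⟩ := Nat.exists_eq_add_of_le (not_lt.1 hn)
      have hj : (0 : ℝ) ≤ j := j.cast_nonneg
      have hle : (j : ℝ) + 2 ≤ ν + ((N + 2 + j : ℕ) : ℝ) := by push_cast; linarith [hν.1]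
      have hΓ : (j ! : ℝ) ≤ Real.Gamma (ν + ((N + 2 + j : ℕ) : ℝ)) := by
        calc (j ! : ℝ) ≤ ((j + 1) ! : ℝ) := by exact_mod_cast Nat.factorial_le (Nat.le_succ j)
          _ = Real.Gamma ((j : ℝ) + 2) := by
            rw [← Real.Gamma_nat_eq_factorial]; push_cast; ring_nf
          _ ≤ _ := Real.Gamma_strictMonoOn_Ici.monotoneOn (by simp) (mem_Ici.2 (by linarith)) hle
      rw [Nat.add_sub_cancel_left, Real.norm_of_nonneg (rGamma_nonneg (by linarith))]
      exact inv_anti₀ (by positivity) hΓ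

theorem summable_norm_normHypTerm (H : IsLogConcaveSeq (hypCoeff a b) R) (ν x : ℝ) :
    Summable fun n => ‖normHypTerm a b ν x n‖ := by
  obtain ⟨N, hN⟩ := exists_nat_ge |ν|
  obtain ⟨u, hu, hle⟩ := H.exists_summable_bound N x
  exact hu.of_nonneg_of_le (fun _ => norm_nonneg _) fun n => hle n ν (abs_le.1 hN)

theorem summable_normHypTerm (H : IsLogConcaveSeq (hypCoeff a b) R) (ν x : ℝ) :
    Summable (normHypTerm a b ν x) := (H.summable_norm_normHypTerm ν x).of_norm

theorem continuous_normHyp (H : IsLogConcaveSeq (hypCoeff a b) R) (x : ℝ) :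
    Continuous fun ν => normHyp a b ν x := by
  -- The series converges uniformly for `ν` in each interval `[-N, N]`.
  rw [continuous_iff_continuousAt]
  intro ν
  obtain ⟨N, hN⟩ := exists_nat_gt |ν|
  obtain ⟨u, hu, hle⟩ := H.exists_summable_bound N x
  have hc : ContinuousOn (fun ν => normHyp a b ν x) (Icc (-(N : ℝ)) N) := by
    refine continuousOn_tsum (fun n => ?_) hu hle
    simp only [normHypTerm_eq]
    exact (continuous_const.mul
      (continuous_rGamma.comp (continuous_id.add continuous_const))).continuousOn
  exact hc.continuousAt (Icc_mem_nhds (abs_lt.1 hN).1 (abs_lt.1 hN).2)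

theorem normHyp_eq_genHyp (H : IsLogConcaveSeq (hypCoeff a b) R) {ν : ℝ}
    (hν : ∀ k : ℕ, ν ≠ -(k : ℝ)) (x : ℝ) :
    Summable (hypTerm a (ν ::ₘ b) x) ∧
      normHyp a b ν x = (Real.Gamma ν)⁻¹ * genHyp a (ν ::ₘ b) x := by
  have he : hypTerm a (ν ::ₘ b) x = fun n => Real.Gamma ν * normHypTerm a b ν x n :=
    funext fun n => hypTerm_cons_eq a b hν x n
  refine ⟨he ▸ (H.summable_normHypTerm ν x).mul_left _, ?_⟩
  rw [genHyp, he, tsum_mul_left, inv_mul_cancel_left₀ (Real.Gamma_ne_zero hν), normHyp]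

theorem normHyp_pos_of_pos (H : IsLogConcaveSeq (hypCoeff a b) R) {ν x : ℝ} (hν : 0 < ν)
    (hx : 0 ≤ x) : 0 < normHyp a b ν x := by
  refine (H.summable_normHypTerm ν x).tsum_pos (fun n => ?_) 0
    (by rw [normHypTerm_zero]; exact rGamma_pos hν)
  rw [normHypTerm_eq]
  exact mul_nonneg (mul_nonneg (H.pos n).le (pow_nonneg hx n)) (rGamma_nonneg (by positivity))

theorem normHyp_pos_of_nonneg (H : IsLogConcaveSeq (hypCoeff a b) R) {ν x : ℝ} (hν : 0 ≤ ν)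
    (hx : 0 < x) : 0 < normHyp a b ν x := by
  refine (H.summable_normHypTerm ν x).tsum_pos (fun n => ?_) 1 ?_ <;> rw [normHypTerm_eq]
  · exact mul_nonneg (mul_nonneg (H.pos n).le (pow_nonneg hx.le n)) (rGamma_nonneg (by positivity))
  · exact mul_pos (mul_pos (H.pos 1) (pow_pos hx 1)) (rGamma_pos (by positivity))

theorem hasSum_normHyp_mul (H : IsLogConcaveSeq (hypCoeff a b) R) (s t x : ℝ) :
    HasSum (fun m => (∑ k ∈ Finset.range (m + 1), hypCoeff a b k * hypCoeff a b (m - k) *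
      (rGamma (s + k) * rGamma (t + (m - k : ℕ)))) * x ^ m)
      (normHyp a b s x * normHyp a b t x) := by
  convert! hasSum_sum_range_mul_of_summable_norm (H.summable_norm_normHypTerm s x)
    (H.summable_norm_normHypTerm t x) using 2 with m
  rw [Finset.sum_mul]
  refine Finset.sum_congr rfl fun k hk => ?_
  have hxk : x ^ m = x ^ k * x ^ (m - k) := by
    rw [← pow_add, Nat.add_sub_cancel' (Nat.lt_succ_iff.1 (Finset.mem_range.1 hk))]
  rw [normHypTerm_eq, normHypTerm_eq, hxk]
  ring

theorem hasSum_hypTuranian (H : IsLogConcaveSeq (hypCoeff a b) R) (β μ x : ℝ) :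
    HasSum (fun m => turanCoeff (hypCoeff a b) β μ m * x ^ m) (hypTuranian a b β μ x) := by
  rw [hypTuranian]
  convert! (H.hasSum_normHyp_mul (μ + 1) (μ + β) x).sub
    (H.hasSum_normHyp_mul μ (μ + β + 1) x) using 2 with m
  rw [turanCoeff, ← sub_mul, ← Finset.sum_sub_distrib]
  congr 1
  refine Finset.sum_congr rfl fun k _ => ?_
  rw [turanTerm_eq, mul_sub]

theorem hasSum_ratio (H : IsLogConcaveSeq (hypCoeff a b) R) (β μ x : ℝ) :
    HasSum (fun m => ratioCoeff (hypCoeff a b) β μ m * x ^ m)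
      ((μ + β) * (normHyp a b μ x * normHyp a b (μ + β + 1) x) -
        μ * (normHyp a b (μ + 1) x * normHyp a b (μ + β) x)) := by
  convert! ((H.hasSum_normHyp_mul μ (μ + β + 1) x).mul_left (μ + β)).sub
    ((H.hasSum_normHyp_mul (μ + 1) (μ + β) x).mul_left μ) using 2 with m
  rw [ratioCoeff, ← mul_assoc, ← mul_assoc, ← sub_mul, Finset.mul_sum, Finset.mul_sum,
    ← Finset.sum_sub_distrib]
  congr 1
  refine Finset.sum_congr rfl fun k _ => ?_
  rw [ratioTerm_eq]
  ring

/-! ### The Turanian -/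

variable {β μ : ℝ}

theorem hasNonnegPowerSeries_hypTuranian (H : IsLogConcaveSeq (hypCoeff a b) R) (hμ : -1 ≤ μ)
    (hβ : 0 < β) (hμβ : 0 ≤ μ + β) : HasNonnegPowerSeries (hypTuranian a b β μ) :=
  ⟨_, H.turanCoeff_nonneg hμ hβ hμβ, H.hasSum_hypTuranian β μ⟩

theorem hypTuranian_zero_lt (H : IsLogConcaveSeq (hypCoeff a b) R) (hμ : -1 ≤ μ) (hβ : 0 < β)
    (hμβ : 0 ≤ μ + β) (h2 : 0 < turanCoeff (hypCoeff a b) β μ 2) {x : ℝ} (hx : 0 < x) :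
    hypTuranian a b β μ 0 < hypTuranian a b β μ x := by
  refine hasSum_lt (i := 2) (fun m => mul_le_mul_of_nonneg_left
    (pow_le_pow_left₀ le_rfl hx.le m) (H.turanCoeff_nonneg hμ hβ hμβ m)) ?_
    (H.hasSum_hypTuranian β μ 0) (H.hasSum_hypTuranian β μ x)
  simp only [ne_eq, OfNat.ofNat_ne_zero, not_false_eq_true, zero_pow, mul_zero]
  positivity

theorem hypTuranian_pos_of_neg_one_lt (H : IsLogConcaveSeq (hypCoeff a b) R) (hμ : -1 < μ)
    (hβ : 0 < β) (hμβ : 0 ≤ μ + β) {x : ℝ} (hx : 0 ≤ x) : 0 < hypTuranian a b β μ x := by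
  refine lt_of_lt_of_le ?_
    ((H.hasNonnegPowerSeries_hypTuranian hμ.le hβ hμβ).monotone le_rfl hx)
  rw [hypTuranian_zero]
  exact mul_pos (mul_pos hβ (rGamma_pos (by linarith))) (rGamma_pos (by linarith))

/-- Positivity of the Turanian says that `ν ↦ g (ν + 1) / g ν` strictly decreases; multiplying
`h` such quotients gives the statement for a shift by `h`. -/
theorem strictDiscreteWrightLogConcaveOn_normHyp (H : IsLogConcaveSeq (hypCoeff a b) R) {x : ℝ}
    (hx : 0 ≤ x) : StrictDiscreteWrightLogConcaveOn (fun ν => normHyp a b ν x) (Ioi 0) := by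
  refine ⟨fun ν hν => H.normHyp_pos_of_pos hν hx, (H.continuous_normHyp x).continuousOn, ?_⟩
  intro h hh s hs ν hν _
  rw [mem_Ioi] at hν
  have hstep : ∀ κ : ℝ, 0 < κ → normHyp a b κ x * normHyp a b (κ + s + 1) x <
      normHyp a b (κ + 1) x * normHyp a b (κ + s) x := fun κ hκ =>
    sub_pos.1 (H.hypTuranian_pos_of_neg_one_lt (β := s) (μ := κ) (by linarith) hs (by linarith) hx)
  simp only [sub_pos]
  induction h, hh using Nat.le_induction with
  | base =>
    have := hstep ν hν
    rw [Nat.cast_one, show ν + 1 + s = ν + s + 1 by ring]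
    exact this
  | succ n _ ih =>
    have hn : (0 : ℝ) ≤ n := n.cast_nonneg
    have h1 := hstep (ν + n) (by linarith)
    rw [Nat.cast_succ, show ν + ((n : ℝ) + 1) + s = ν + n + s + 1 by ring, ← add_assoc]
    have p1 : 0 < normHyp a b (ν + n) x := H.normHyp_pos_of_pos (by linarith) hx
    have p2 : 0 < normHyp a b (ν + n + s) x := H.normHyp_pos_of_pos (by linarith) hx
    have p3 : 0 < normHyp a b (ν + n + 1) x := H.normHyp_pos_of_pos (by linarith) hx
    have p4 : 0 < normHyp a b ν x := H.normHyp_pos_of_pos hν hx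
    refine lt_of_mul_lt_mul_left (a := normHyp a b (ν + n) x * normHyp a b (ν + n + s) x) ?_
      (mul_pos p1 p2).le
    calc _ = normHyp a b ν x * normHyp a b (ν + n + s) x *
          (normHyp a b (ν + n) x * normHyp a b (ν + n + s + 1) x) := by ring
      _ < normHyp a b ν x * normHyp a b (ν + n + s) x *
          (normHyp a b (ν + n + 1) x * normHyp a b (ν + n + s) x) :=
        mul_lt_mul_of_pos_left h1 (mul_pos p4 p2)
      _ < normHyp a b (ν + n) x * normHyp a b (ν + s) x *
          (normHyp a b (ν + n + 1) x * normHyp a b (ν + n + s) x) :=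
        mul_lt_mul_of_pos_right (ih (show (0 : ℝ) < ν + n + s by linarith)) (mul_pos p3 p2)
      _ = _ := by ring

theorem ratio_gt (H : IsLogConcaveSeq (hypCoeff a b) R) (hμ : -1 ≤ μ) (hβ : 0 < β)
    (hμβ : 0 < μ + β) {x : ℝ} (hx : 0 < x) :
    μ * (normHyp a b (μ + 1) x * normHyp a b (μ + β) x) <
      (μ + β) * (normHyp a b μ x * normHyp a b (μ + β + 1) x) := by
  have hs := H.hasSum_ratio β μ x
  rw [← sub_pos, ← hs.tsum_eq]
  refine hs.summable.tsum_pos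
    (fun m => mul_nonneg (H.ratioCoeff_nonneg hμ hβ hμβ m) (pow_nonneg hx.le m)) 1 ?_
  exact mul_pos (H.ratioCoeff_one_pos hμ hβ hμβ) (pow_pos hx 1)

end IsLogConcaveSeq

/-! ### The Turanian and the quotient of hypergeometric functions -/

theorem mainTheorem10 (a b : Multiset ℝ)
    (hpq : a.card ≤ b.card + 1)
    (ha : ∀ t ∈ a, 0 < t) (hb : ∀ t ∈ b, 0 < t)
    (hchain : SymmChain a (1 ::ₘ b)) :
    -- `normHyp a b` is the function `g`
    ((∀ ν x : ℝ, Summable (normHypTerm a b ν x)) ∧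
      (∀ x : ℝ, Continuous fun ν => normHyp a b ν x) ∧
      ∀ ν : ℝ, (∀ k : ℕ, ν ≠ -(k : ℝ)) → ∀ x : ℝ,
        Summable (hypTerm a (ν ::ₘ b) x) ∧
        normHyp a b ν x = (Real.Gamma ν)⁻¹ * genHyp a (ν ::ₘ b) x) ∧
    -- strict discrete Wright log-concavity
    (∀ x : ℝ, 0 ≤ x → StrictDiscreteWrightLogConcaveOn (fun ν => normHyp a b ν x) (Ioi 0)) ∧
    ∀ μ β : ℝ, -1 ≤ μ → 0 < β → 0 ≤ μ + β →
      -- positive power series coefficients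
      (∃ c : ℕ → ℝ,
        (∀ x : ℝ, HasSum (fun m => c m * x ^ m) (hypTuranian a b β μ x)) ∧
        (∀ m, 0 ≤ c m) ∧
        (-1 < μ → ∀ m, 0 < c m) ∧
        (μ = -1 → 1 < β → ∀ m, 1 ≤ m → 0 < c m) ∧
        (μ = -1 → β = 1 → a ≠ 1 ::ₘ b → ∀ m, 2 ≤ m → 0 < c m)) ∧
      AbsolutelyMonotoneOn (hypTuranian a b β μ) (Ioi 0) ∧
      MultiplicativelyConvexOn (hypTuranian a b β μ) (Ioi 0) ∧
      -- complete monotonicity in `1 / x` and the integral representation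
      CompletelyMonotoneOn (fun y => hypTuranian a b β μ (1 / y)) (Ioi 0) ∧
      LogConvexOn (fun y => hypTuranian a b β μ (1 / y)) (Ioi 0) ∧
      (∃ τ : MeasureTheory.Measure ℝ, τ (Iio 0) = 0 ∧
        ∀ x : ℝ, 0 < x →
          MeasureTheory.Integrable (fun t => Real.exp (-t / x)) τ ∧
          hypTuranian a b β μ x = ∫ t in Ici (0 : ℝ), Real.exp (-t / x) ∂τ) ∧
      -- two-sided bounds for the quotient
      (∀ x : ℝ, 0 < x →
        0 < normHyp a b (1 + μ) x * normHyp a b (β + μ) x ∧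
        (0 < μ + β →
          μ / (β + μ) < (normHyp a b μ x * normHyp a b (1 + β + μ) x) /
            (normHyp a b (1 + μ) x * normHyp a b (β + μ) x)) ∧
        (¬ (μ = -1 ∧ β = 1 ∧ a = 1 ::ₘ b) →
          (normHyp a b μ x * normHyp a b (1 + β + μ) x) /
            (normHyp a b (1 + μ) x * normHyp a b (β + μ) x) < 1)) ∧
      (-1 < μ → 0 < μ + β →
        0 < normHyp a b (1 + μ) 0 * normHyp a b (β + μ) 0 ∧
        μ / (β + μ) = (normHyp a b μ 0 * normHyp a b (1 + β + μ) 0) /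
            (normHyp a b (1 + μ) 0 * normHyp a b (β + μ) 0) ∧
        (normHyp a b μ 0 * normHyp a b (1 + β + μ) 0) /
            (normHyp a b (1 + μ) 0 * normHyp a b (β + μ) 0) < 1) ∧
      -- lower bound for the Turanian, with equality only at `x = 0`
      (∀ x : ℝ, 0 ≤ x →
        β * (Real.Gamma (μ + 1))⁻¹ * (Real.Gamma (μ + β + 1))⁻¹ ≤ hypTuranian a b β μ x) ∧
      β * (Real.Gamma (μ + 1))⁻¹ * (Real.Gamma (μ + β + 1))⁻¹ = hypTuranian a b β μ 0 ∧
      (¬ (μ = -1 ∧ β = 1 ∧ a = 1 ::ₘ b) → ∀ x : ℝ, 0 < x →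
        β * (Real.Gamma (μ + 1))⁻¹ * (Real.Gamma (μ + β + 1))⁻¹ < hypTuranian a b β μ x) := by
  have H := isLogConcaveSeq_hypCoeff hpq ha hb hchain
  refine ⟨⟨H.summable_normHypTerm, H.continuous_normHyp, fun ν hν x => H.normHyp_eq_genHyp hν x⟩,
    fun x hx => H.strictDiscreteWrightLogConcaveOn_normHyp hx, fun μ β hμ hβ hμβ => ?_⟩
  have hF := H.hasNonnegPowerSeries_hypTuranian hμ hβ hμβ
  have hstrict : μ = -1 → β = 1 → a ≠ 1 ::ₘ b → ∀ m, 2 ≤ m →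
      0 < turanCoeff (hypCoeff a b) β μ m := by
    rintro rfl rfl hne m hm
    exact H.turanCoeff_neg_one_one_pos (shiftProd_ratio_strictAnti hpq ha hb hchain hne) hm
  have hgt : μ = -1 → 1 < β → ∀ m, 1 ≤ m → 0 < turanCoeff (hypCoeff a b) β μ m := by
    rintro rfl hβ1 m hm
    exact H.turanCoeff_neg_one_pos hβ1 hm
  -- The coefficient of `x ^ 2` is positive in every case that is not exceptional; it makes the
  -- Turanian strictly larger at `x > 0` than at `0`.
  have htwo : ¬ (μ = -1 ∧ β = 1 ∧ a = 1 ::ₘ b) → 0 < turanCoeff (hypCoeff a b) β μ 2 := by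
    intro hne
    rcases hμ.lt_or_eq with h1 | h1
    · exact H.turanCoeff_pos h1 hβ hμβ 2
    · rcases (show 1 ≤ β by linarith).lt_or_eq with h2 | h2
      · exact hgt h1.symm h2 2 one_le_two
      · exact hstrict h1.symm h2.symm (fun h3 => hne ⟨h1.symm, h2.symm, h3⟩) 2 le_rfl
  have h0 : β * (Real.Gamma (μ + 1))⁻¹ * (Real.Gamma (μ + β + 1))⁻¹ = hypTuranian a b β μ 0 :=
    (hypTuranian_zero a b β μ).symm
  refine ⟨⟨turanCoeff (hypCoeff a b) β μ, H.hasSum_hypTuranian β μ, H.turanCoeff_nonneg hμ hβ hμβ,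
      fun h => H.turanCoeff_pos h hβ hμβ, hgt, hstrict⟩, hF.absolutelyMonotoneOn,
    hF.multiplicativelyConvexOn, hF.completelyMonotoneOn_one_div, hF.logConvexOn_one_div,
    hF.exists_measure_laplace, fun x hx => ?_, fun hμ1 hμβ1 => ?_, fun x hx => ?_, h0,
    fun hne x hx => ?_⟩
  · rw [add_comm 1 μ, add_comm β μ, show 1 + β + μ = μ + β + 1 by ring]
    have hden : 0 < normHyp a b (μ + 1) x * normHyp a b (μ + β) x :=
      mul_pos (H.normHyp_pos_of_nonneg (by linarith) hx) (H.normHyp_pos_of_nonneg hμβ hx)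
    refine ⟨hden, fun hμβ1 => ?_, fun hne => ?_⟩
    · rw [div_lt_div_iff₀ hμβ1 hden, mul_comm _ (μ + β)]
      exact H.ratio_gt hμ hβ hμβ1 hx
    · rw [div_lt_one hden, ← sub_pos]
      exact (hF.nonneg le_rfl).trans_lt (H.hypTuranian_zero_lt hμ hβ hμβ (htwo hne) hx)
  · rw [add_comm 1 μ, add_comm β μ, show 1 + β + μ = μ + β + 1 by ring]
    simp only [normHyp_zero_right]
    have p1 := rGamma_pos (show 0 < μ + 1 by linarith)
    have p2 := rGamma_pos hμβ1
    have p3 := rGamma_pos (show 0 < μ + β + 1 by linarith)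
    have hq : μ / (μ + β) = rGamma μ * rGamma (μ + β + 1) / (rGamma (μ + 1) * rGamma (μ + β)) := by
      rw [rGamma_eq_mul_add_one μ, rGamma_eq_mul_add_one (μ + β)]
      field_simp
    refine ⟨mul_pos p1 p2, hq, ?_⟩
    rw [← hq, div_lt_one hμβ1]
    linarith
  · rw [h0]
    exact hF.monotone le_rfl hx
  · rw [h0]
    exact H.hypTuranian_zero_lt hμ hβ hμβ (htwo hne) hx
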